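/- Let $G=(V,E)$ be a finite simple undirected graph with $n$ vertices and $m$ edges, and let $c,k\in\mathbb N$. A $c$-colored labeling of $G$ is a partition of $E$ into $c$ (possibly empty) strong color classes $S^1,\dots,S^c$ and one class $W$ of weak edges; it is an STC-labeling if there are no $i$ and no two distinct edges $\{u,v\},\{v,w\}\in S^i$ with $\{u,w\}\notin E$. The problem Multi Strong Triadic Closure (Multi-STC) asks, for an instance $(G,c,k)$, whether $G$ has a $c$-colored STC-labeling with $|W|\le k$. For $t\in\mathbb N$ let $\xi_t=\xi_t(G)$ be the minimum size of a set $D\subseteq E$ such that $(V,E\setminus D)$ has maximum degree at most $t$. Theorem. (1) Multi-STC, restricted to instances with $c\ge 3$, admits a problem kernel with $O(\xi_{\lfloor c/2\rfloor+1}\cdot c)$ vertices and $O(\xi_{\lfloor c/2\rfloor+1}\cdot c^2)$ edges that can be computed in $O(n+m)$ time. That is, there are one algorithm and an absolute constant $\kappa$ such that, on every instance $(G,c,k)$ with $c\ge 3$ ($G$ given by its number of vertices and a list of its edges), the algorithm computes in at most $\kappa\,(n+m+1)$ steps on a random access machine with words of $O(\log(n+m+c+k+2))$ bits an instance $(G',c,k')$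 which is a yes-instance if and only if $(G,c,k)$ is one, where $G'$ has at most $\kappa\,\xi_{\lfloor c/2\rfloor+1}(G)\,c$ vertices and at most $\kappa\,\xi_{\lfloor c/2\rfloor+1}(G)\,c^2$ edges, and $k'\le k$ and $k'\le|E(G')|$. (2) In particular, Multi-STC has kernels of linear size in $\xi_{c-1}$ for $c\le 4$: in the same sense, Multi-STC restricted to instances with $1\le c\le 4$ admits a problem kernel with $O(\xi_{c-1})$ vertices and $O(\xi_{c-1})$ edges that can be computed in $O(n+m)$ time. -/

import Mathlib

namespace MultiSTC

/-! ### The problem Multi Strong Triadic Closure -/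

section Problem

variable {V : Type*}

/-- A `c`-colored labeling of the edges is given by a function `L : Sym2 V → Option (Fin c)`, of which
only the values on the edges of `G` matter: `L e = some i` says that `e` has the strong color `i`, and
`L e = none` says that `e` is weak. It is an STC-labeling if no two edges `{u, v}` and `{v, w}` with
`u ≠ w` and with `{u, w}` not an edge have the same strong color. -/
def IsSTCLabeling (G : SimpleGraph V) {c : ℕ} (L : Sym2 V → Option (Fin c)) : Prop :=
  ∀ u v w : V, G.Adj u v → G.Adj v w → u ≠ w → ¬ G.Adj u w →
    ∀ i : Fin c, ¬ (L s(u, v) = some i ∧ L s(v, w) = some i)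

/-- The set of weak edges of a labeling. -/
def weakEdges (G : SimpleGraph V) {c : ℕ} (L : Sym2 V → Option (Fin c)) : Set (Sym2 V) :=
  {e | e ∈ G.edgeSet ∧ L e = none}

/-- `D` is an edge-deletion set of `G` and `t`: a set of edges of `G` such that deleting it leaves a
graph in which every vertex has at most `t` neighbors. -/
def IsEdgeDeletionSet (G : SimpleGraph V) (t : ℕ) (D : Finset (Sym2 V)) : Prop :=
  (D : Set (Sym2 V)) ⊆ G.edgeSet ∧
    ∀ v : V, ((G.deleteEdges (D : Set (Sym2 V))).neighborSet v).ncard ≤ t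

/-- The parameter `ξ_t` of a finite graph: the size of a minimum edge-deletion set of `G` and `t`. -/
noncomputable def xi (G : SimpleGraph V) (t : ℕ) : ℕ :=
  sInf {s : ℕ | ∃ D : Finset (Sym2 V), IsEdgeDeletionSet G t D ∧ D.card = s}

end Problem

/-- An instance `(G, c, k)` of Multi-STC, where `G` has the vertices `0, …, n - 1`. -/
structure STCInstance where
  n : ℕ
  graph : SimpleGraph (Fin n)
  c : ℕ
  k : ℕ

/-- The number of edges of the graph of an instance. -/
noncomputable def STCInstance.m (I : STCInstance) : ℕ := I.graph.edgeSet.ncard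

/-- `(G, c, k)` is a yes-instance: there is a `c`-colored STC-labeling with at most `k` weak edges. -/
def STCInstance.IsYes (I : STCInstance) : Prop :=
  ∃ L : Sym2 (Fin I.n) → Option (Fin I.c),
    IsSTCLabeling I.graph L ∧ (weakEdges I.graph L).ncard ≤ I.k

/-! ### Random access machines

A program works on scalar registers and one-dimensional arrays, of which it mentions only finitely many,
that hold natural numbers. Array cells are addressed indirectly, through the content of a register.
Every elementary instruction and every evaluation of a test takes one step. -/

/-- The arithmetic operations: addition, truncated subtraction, multiplication, and division with
rounding down (`x / 0 = 0`). -/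
inductive ArithOp where
  | add
  | sub
  | mul
  | div

def ArithOp.eval : ArithOp → ℕ → ℕ → ℕ
  | .add, x, y => x + y
  | .sub, x, y => x - y
  | .mul, x, y => x * y
  | .div, x, y => x / y

/-- Tests compare the contents of two registers. -/
inductive RegTest where
  | lt (x y : ℕ)
  | eq (x y : ℕ)

/-- Programs. Registers and arrays are named by natural numbers. -/
inductive Program where
  /-- `x := v` for a constant `v` -/
  | const (x v : ℕ)
  /-- `x := y ∘ z` for registers `y`, `z` -/
  | arith (op : ArithOp) (x y z : ℕ)
  /-- `x := a[y]` -/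
  | load (x a y : ℕ)
  /-- `a[x] := y` -/
  | store (a x y : ℕ)
  /-- first `p`, then `q` -/
  | seq (p q : Program)
  /-- if `b` then `p` else `q` -/
  | cond (b : RegTest) (p q : Program)
  /-- while `b` do `p` -/
  | loop (b : RegTest) (p : Program)

/-- Memory contents. -/
structure Memory where
  reg : ℕ → ℕ
  arr : ℕ → ℕ → ℕ

def Memory.setReg (σ : Memory) (x v : ℕ) : Memory :=
  { σ with reg := Function.update σ.reg x v }

def Memory.setArr (σ : Memory) (a i v : ℕ) : Memory :=
  { σ with arr := Function.update σ.arr a (Function.update (σ.arr a) i v) }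

def RegTest.Holds (σ : Memory) : RegTest → Prop
  | .lt x y => σ.reg x < σ.reg y
  | .eq x y => σ.reg x = σ.reg y

/-- `Exec W p σ t τ`: started with the memory contents `σ`, the program `p` terminates after exactly
`t` steps with the memory contents `τ`, and no number that it computes on the way exceeds the largest
machine word `W`. (There is no `τ` if `p` does not terminate or computes a number larger than `W`.) -/
inductive Exec (W : ℕ) : Program → Memory → ℕ → Memory → Prop
  | const (σ : Memory) (x v : ℕ) (hv : v ≤ W) :
      Exec W (.const x v) σ 1 (σ.setReg x v)
  | arith (σ : Memory) (op : ArithOp) (x y z : ℕ) (hv : op.eval (σ.reg y) (σ.reg z) ≤ W) :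
      Exec W (.arith op x y z) σ 1 (σ.setReg x (op.eval (σ.reg y) (σ.reg z)))
  | load (σ : Memory) (x a y : ℕ) :
      Exec W (.load x a y) σ 1 (σ.setReg x (σ.arr a (σ.reg y)))
  | store (σ : Memory) (a x y : ℕ) :
      Exec W (.store a x y) σ 1 (σ.setArr a (σ.reg x) (σ.reg y))
  | seq {p q : Program} {σ₀ σ₁ σ₂ : Memory} {t₁ t₂ : ℕ}
      (h₁ : Exec W p σ₀ t₁ σ₁) (h₂ : Exec W q σ₁ t₂ σ₂) :
      Exec W (.seq p q) σ₀ (t₁ + t₂) σ₂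
  | condTrue {b : RegTest} {p q : Program} {σ₀ σ₁ : Memory} {t : ℕ}
      (hb : b.Holds σ₀) (h : Exec W p σ₀ t σ₁) :
      Exec W (.cond b p q) σ₀ (t + 1) σ₁
  | condFalse {b : RegTest} {p q : Program} {σ₀ σ₁ : Memory} {t : ℕ}
      (hb : ¬ b.Holds σ₀) (h : Exec W q σ₀ t σ₁) :
      Exec W (.cond b p q) σ₀ (t + 1) σ₁
  | loopFalse {b : RegTest} {p : Program} {σ : Memory} (hb : ¬ b.Holds σ) :
      Exec W (.loop b p) σ 1 σ
  | loopTrue {b : RegTest} {p : Program} {σ₀ σ₁ σ₂ : Memory} {t₁ t₂ : ℕ}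
      (hb : b.Holds σ₀) (h₁ : Exec W p σ₀ t₁ σ₁) (h₂ : Exec W (.loop b p) σ₁ t₂ σ₂) :
      Exec W (.loop b p) σ₀ (t₁ + t₂ + 1) σ₂

/-! ### Encoding of instances -/

/-- `l` lists every edge of `G` exactly once, in some order and with its endpoints in some order. -/
def IsEdgeList {n : ℕ} (G : SimpleGraph (Fin n)) (l : List (Fin n × Fin n)) : Prop :=
  (l.map fun e => s(e.1, e.2)).Nodup ∧
    ∀ e : Sym2 (Fin n), e ∈ l.map (fun e => s(e.1, e.2)) ↔ e ∈ G.edgeSet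

/-- The memory contains the instance `I`, with its edges listed as in `l`: the registers 0, 1, 2, 3
contain the number of vertices, the number of edges, `c` and `k`, and the cells `i` of the arrays
0 and 1 contain the endpoints of the `i`-th edge. -/
def Stores (σ : Memory) (I : STCInstance) (l : List (Fin I.n × Fin I.n)) : Prop :=
  IsEdgeList I.graph l ∧
    σ.reg 0 = I.n ∧ σ.reg 1 = l.length ∧ σ.reg 2 = I.c ∧ σ.reg 3 = I.k ∧
    ∀ (i : ℕ) (hi : i < l.length), σ.arr 0 i = (l[i].1 : ℕ) ∧ σ.arr 1 i = (l[i].2 : ℕ)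

/-- The memory is an admissible start for the input `I`: it contains the instance `I`, with its edges
listed as in `l`, and is zero everywhere else. -/
def IsInput (σ : Memory) (I : STCInstance) (l : List (Fin I.n × Fin I.n)) : Prop :=
  Stores σ I l ∧ (∀ x, 4 ≤ x → σ.reg x = 0) ∧
    ∀ a i, 2 ≤ a ∨ l.length ≤ i → σ.arr a i = 0

/-! ### Kernels -/

/-- Multi-STC, restricted to the instances whose number `c` of colors lies in `C`, admits a problem
kernel with `O(f)` vertices and `O(g)` edges that can be computed in `O(n + m)` time: one program on a
machine whose words have `log₂ (n + m + c + k + 1) + O(1)` bits takes every such instance `(G, c, k)` in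
`O(n + m + 1)` steps to an equivalent instance `(G', c, k')` where `G'` obeys the two bounds and `k'`
is at most `k` and at most the number of edges of `G'`, so that the size of the whole output is bounded
through `f`, `g` and `c`. The hidden factor `κ` is an absolute constant. -/
def AdmitsLinearTimeKernel (C : Set ℕ) (f g : STCInstance → ℕ) : Prop :=
  ∃ (P : Program) (κ : ℕ), ∀ I : STCInstance, I.c ∈ C →
    ∀ (l : List (Fin I.n × Fin I.n)) (σ : Memory), IsInput σ I l →
      ∃ (t : ℕ) (τ : Memory) (I' : STCInstance) (l' : List (Fin I'.n × Fin I'.n)),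
        Exec (κ * (I.n + I.m + I.c + I.k + 1)) P σ t τ ∧
        t ≤ κ * (I.n + I.m + 1) ∧
        Stores τ I' l' ∧
        (I'.IsYes ↔ I.IsYes) ∧
        I'.c = I.c ∧ I'.k ≤ I.k ∧ I'.k ≤ I'.m ∧
        I'.n ≤ κ * f I ∧
        I'.m ≤ κ * g I

end MultiSTC

/-! Fix a degree bound `t` and call an edge low if both endpoints have degree at most `t`. A low
edge touches at most `2 * (t - 1)` other edges. If this is less than `c`, a low edge never has to be
weak, and the kernel may consist of the vertices of degree more than `t` (the high vertices) and
their neighbors.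

The hard case is one color short: `2 * (t - 1) = c` and `t ≥ 3`. Extend a labeling of the kernel
with as few weak edges as possible in the low components that leave the kernel. If such an edge is
still weak, then the edges touching it carry every color exactly once, and its endpoints have degree
`t` and no common neighbor (`IsOptimal.tight`). So it can exchange its label with any touching edge
of the component (`IsOptimal.move`): the weak edge wanders through the component, and every position
it reaches is tight again. A cycle with an extra edge at one of its vertices contradicts this.
Walking around the cycle forces two colors on it to agree (`IsOptimal.color_eq_of_cycle`), while
walking around the three edges at that vertex exchanges one of these colors with another one
(`IsOptimal.not_weak_of_cycle`).

Such cycles are provided by peeling: vertices of degree `t` with at most one untaken low neighbor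
are taken into a set `D` for as long as possible, and `D` joins the kernel. Outside `D`, every
vertex of degree `t` keeps two low neighbors outside `D`, so a longest path avoiding `D` closes up
to a cycle (`IsOptimal.strong_of_isReduced`). The set `D` is small: low degrees on `D` sum to at
most `2 * D.card` (`IsPeeled.sum_card_le`), so vertices of degree `t ≥ 3` must send many edges to
high vertices, whose total degree is at most `2 * xi G t * (t + 1)`.

Linear time needs no adjacency lists. For each vertex it suffices to store the number of its untaken
low neighbors and the sum of their names modulo `n`: when one neighbor is left, the sum is its name.
-/

namespace MultiSTC

/-! ### Optimal completions and the movement of weak edges -/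

section Completion

variable {V : Type*} [Fintype V] {c : ℕ}

open Classical in
/-- The neighbors of a vertex as a finite set. -/
noncomputable def nbhd (G : SimpleGraph V) (v : V) : Finset V :=
  Finset.univ.filter fun w => G.Adj v w

@[simp] theorem mem_nbhd {G : SimpleGraph V} {v w : V} : w ∈ nbhd G v ↔ G.Adj v w := by
  simp [nbhd]

/-- `f` is an edge different from `e` that shares an endpoint with `e`. -/
def Touches (G : SimpleGraph V) (e f : Sym2 V) : Prop :=
  f ∈ G.edgeSet ∧ f ≠ e ∧ ∃ v, v ∈ e ∧ v ∈ f

omit [Fintype V] in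
theorem Touches.symm {G : SimpleGraph V} {e f : Sym2 V} (h : Touches G e f) (he : e ∈ G.edgeSet) :
    Touches G f e := by
  obtain ⟨_, h2, v, h3, h4⟩ := h
  exact ⟨he, h2.symm, v, h4, h3⟩

/-- `L` is an STC-labeling that agrees with `L₀` outside of the set `F`. -/
structure IsCompletion (G : SimpleGraph V) (F : Set (Sym2 V)) (L₀ L : Sym2 V → Option (Fin c)) :
    Prop where
  stc : IsSTCLabeling G L
  agree : ∀ e ∉ F, L e = L₀ e

/-- A completion with as few weak edges in `F` as possible. -/
structure IsOptimal (G : SimpleGraph V) (F : Set (Sym2 V)) (L₀ L : Sym2 V → Option (Fin c)) :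
    Prop extends IsCompletion G F L₀ L where
  min : ∀ L', IsCompletion G F L₀ L' →
    {e | e ∈ F ∧ L e = none}.ncard ≤ {e | e ∈ F ∧ L' e = none}.ncard

omit [Fintype V] in
theorem exists_isOptimal {G : SimpleGraph V} {F : Set (Sym2 V)} {L₀ : Sym2 V → Option (Fin c)}
    (h : IsSTCLabeling G L₀) : ∃ L, IsOptimal G F L₀ L := by
  classical
  have hex : ∃ s, ∃ L, IsCompletion G F L₀ L ∧ {e | e ∈ F ∧ L e = none}.ncard = s :=
    ⟨_, L₀, ⟨h, fun _ _ => rfl⟩, rfl⟩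
  obtain ⟨L, hL, hs⟩ := Nat.find_spec hex
  refine ⟨L, ⟨hL, fun L' hL' => ?_⟩⟩
  rw [hs]
  exact Nat.find_min' hex ⟨L', hL', rfl⟩

theorem card_touches_le [DecidableEq V] {G : SimpleGraph V} {u v : V} (huv : G.Adj u v)
    (T : Finset (Sym2 V)) (hT : ∀ f ∈ T, Touches G s(u, v) f) :
    T.card ≤ ((nbhd G u).card - 1) + ((nbhd G v).card - 1) := by
  have hsub : T ⊆ ((nbhd G u).erase v).image (fun w => s(u, w)) ∪
      ((nbhd G v).erase u).image (fun w => s(v, w)) := by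
    intro f hf
    obtain ⟨hE, hne, x, hx, hxf⟩ := hT f hf
    obtain ⟨y, rfl⟩ := Sym2.mem_iff_exists.1 hxf
    rw [SimpleGraph.mem_edgeSet] at hE
    rcases Sym2.mem_iff.1 hx with rfl | rfl
    · refine Finset.mem_union_left _ (Finset.mem_image.2 ⟨y, ?_, rfl⟩)
      simp only [Finset.mem_erase, mem_nbhd]
      exact ⟨fun h => hne (by rw [h]), hE⟩
    · refine Finset.mem_union_right _ (Finset.mem_image.2 ⟨y, ?_, rfl⟩)
      simp only [Finset.mem_erase, mem_nbhd]
      exact ⟨fun h => hne (by rw [h, Sym2.eq_swap]), hE⟩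
  refine (Finset.card_le_card hsub).trans ((Finset.card_union_le _ _).trans ?_)
  refine add_le_add (Finset.card_image_le.trans ?_) (Finset.card_image_le.trans ?_)
  · rw [Finset.card_erase_of_mem (by simpa using huv)]
  · rw [Finset.card_erase_of_mem (by simpa using huv.symm)]

/-- All that is known about a weak edge that cannot be avoided. -/
structure IsTight (G : SimpleGraph V) (L : Sym2 V → Option (Fin c)) (e : Sym2 V) : Prop where
  inj : ∀ f g, Touches G e f → Touches G e g → L f = L g → f = g
  ne_none : ∀ f, Touches G e f → L f ≠ none
  surj : ∀ i, ∃ f, Touches G e f ∧ L f = some i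

/-- A color missing on the touching edges that conflict with the weak edge could be given to it,
contradicting optimality. So there are `c` conflicting edges of distinct colors, but at most `2 * (t
- 1) ≤ c` touching edges. Equality holds throughout, and every touching edge is a conflicting one
with a color of its own. -/
theorem IsOptimal.tight {G : SimpleGraph V} {F : Set (Sym2 V)} {L₀ L : Sym2 V → Option (Fin c)}
    (hL : IsOptimal G F L₀ L) {t : ℕ} {u v : V} (huv : G.Adj u v) (he : s(u, v) ∈ F)
    (hu : (nbhd G u).card ≤ t) (hv : (nbhd G v).card ≤ t) (hct : 2 * (t - 1) ≤ c)
    (hw : L s(u, v) = none) :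
    2 * (t - 1) = c ∧ (nbhd G u).card = t ∧ IsTight G L s(u, v) ∧
      ∀ w, G.Adj u w → ¬ G.Adj v w := by
  classical
  -- For an edge `f`, this says that `f` and `s(u, v)` form an induced path, so that they must not
  -- share a strong color.
  set P : Sym2 V → Prop := fun f =>
    ∃ a b d, s(u, v) = s(a, b) ∧ f = s(b, d) ∧ a ≠ d ∧ ¬ G.Adj a d with hP
  have key : ∀ i : Fin c, ∃ f, Touches G s(u, v) f ∧ P f ∧ L f = some i := by
    intro i
    by_contra hcon
    push Not at hcon
    have hne : ∀ a b d, G.Adj b d → a ≠ d → ¬ G.Adj a d → s(u, v) = s(a, b) →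
        L s(b, d) ≠ some i := by
      intro a b d hbd had hnad hab
      refine hcon s(b, d) ⟨hbd, ?_, b, by rw [hab]; simp, by simp⟩ ⟨a, b, d, hab, rfl, had, hnad⟩
      rw [hab]
      intro h
      rw [Sym2.eq_swap, Sym2.congr_left] at h
      exact had h.symm
    have hcomp : IsCompletion G F L₀ (Function.update L s(u, v) (some i)) := by
      refine ⟨?_, fun e' he' => ?_⟩
      · intro a b d hab hbd had hnad j ⟨h1, h2⟩
        have hdiff : s(a, b) ≠ s(b, d) := by
          intro h
          rw [Sym2.eq_swap, Sym2.congr_right] at h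
          exact had h
        by_cases e1 : s(a, b) = s(u, v)
        · have e2 : s(b, d) ≠ s(u, v) := fun h => hdiff (e1.trans h.symm)
          rw [e1, Function.update_self] at h1
          rw [Function.update_of_ne e2, ← h1] at h2
          exact hne a b d hbd had hnad e1.symm h2
        · rw [Function.update_of_ne e1] at h1
          by_cases e2 : s(b, d) = s(u, v)
          · rw [e2, Function.update_self] at h2
            rw [← h2, Sym2.eq_swap] at h1
            exact hne d b a hab.symm had.symm (fun h => hnad h.symm) (by rw [← e2, Sym2.eq_swap]) h1
          · rw [Function.update_of_ne e2] at h2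
            exact hL.stc a b d hab hbd had hnad j ⟨h1, h2⟩
      · rw [Function.update_of_ne (fun h : e' = s(u, v) => he' (h ▸ he))]
        exact hL.agree e' he'
    have hlt : {e | e ∈ F ∧ Function.update L s(u, v) (some i) e = none}.ncard <
        {e | e ∈ F ∧ L e = none}.ncard := by
      refine Set.ncard_lt_ncard ⟨?_, ?_⟩ (Set.toFinite _)
      · rintro e ⟨h1, h2⟩
        by_cases e1 : e = s(u, v)
        · rw [e1, Function.update_self] at h2
          cases h2
        · rw [Function.update_of_ne e1] at h2
          exact ⟨h1, h2⟩
      · intro h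
        have := (h (show s(u, v) ∈ {e | e ∈ F ∧ L e = none} from ⟨he, hw⟩)).2
        rw [Function.update_self] at this
        cases this
    exact absurd (hL.min _ hcomp) (not_le.2 hlt)
  choose g hg1 hg2 hg3 using key
  have ginj : Function.Injective g := by
    intro i j hij
    have := hg3 i
    rw [hij, hg3 j] at this
    exact (Option.some.inj this).symm
  set T : Finset (Sym2 V) := Finset.univ.filter (fun f => Touches G s(u, v) f) with hTdef
  have hTle := card_touches_le huv T (fun f hf => (Finset.mem_filter.1 hf).2)
  have hsub : Finset.univ.image g ⊆ T := by
    intro f hf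
    obtain ⟨i, -, rfl⟩ := Finset.mem_image.1 hf
    exact Finset.mem_filter.2 ⟨Finset.mem_univ _, hg1 i⟩
  have hcard : (Finset.univ.image g).card = c := by
    rw [Finset.card_image_of_injective _ ginj]; simp
  have hcT := Finset.card_le_card hsub
  have hu1 : 1 ≤ (nbhd G u).card := Finset.card_pos.2 ⟨v, by simpa using huv⟩
  have hv1 : 1 ≤ (nbhd G v).card := Finset.card_pos.2 ⟨u, by simpa using huv.symm⟩
  have hTeq : Finset.univ.image g = T := Finset.eq_of_subset_of_card_le hsub (by omega)
  have hrep : ∀ f, Touches G s(u, v) f → ∃ i, g i = f := by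
    intro f hf
    have : f ∈ T := Finset.mem_filter.2 ⟨Finset.mem_univ _, hf⟩
    rw [← hTeq] at this
    obtain ⟨i, -, h⟩ := Finset.mem_image.1 this
    exact ⟨i, h⟩
  refine ⟨by omega, by omega, ⟨?_, ?_, ?_⟩, ?_⟩
  · intro f f' hf hf' hff
    obtain ⟨i, rfl⟩ := hrep f hf
    obtain ⟨j, rfl⟩ := hrep f' hf'
    rw [hg3, hg3] at hff
    rw [Option.some.inj hff]
  · intro f hf
    obtain ⟨i, rfl⟩ := hrep f hf
    rw [hg3]
    simp
  · exact fun i => ⟨g i, hg1 i, hg3 i⟩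
  -- The edge from `u` to a common neighbor `w` touches `s(u, v)` but closes a triangle with it, so
  -- it cannot conflict.
  · intro w huw hvw
    obtain ⟨i, hi⟩ := hrep s(u, w) ⟨huw, by
      intro h
      rw [Sym2.congr_right] at h
      exact hvw.ne h.symm, u, by simp, by simp⟩
    obtain ⟨a, b, d, h1, h2, h3, h4⟩ := hg2 i
    rw [hi] at h2
    rcases Sym2.eq_iff.1 h1 with ⟨rfl, rfl⟩ | ⟨rfl, rfl⟩
    · rcases Sym2.eq_iff.1 h2 with ⟨h, -⟩ | ⟨-, h⟩
      · exact huv.ne h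
      · exact hvw.ne h.symm
    · rcases Sym2.eq_iff.1 h2 with ⟨-, rfl⟩ | ⟨h, h'⟩
      · exact h4 hvw
      · exact huw.ne h'.symm

omit [Fintype V] in
/-- A weak edge can be exchanged with any touching edge. -/
theorem IsOptimal.move [DecidableEq V] {G : SimpleGraph V} {F : Set (Sym2 V)}
    {L₀ L : Sym2 V → Option (Fin c)}
    (hL : IsOptimal G F L₀ L) {e f : Sym2 V} (he : e ∈ F) (hf : f ∈ F) (hw : L e = none)
    (ht : IsTight G L e) (hef : Touches G e f) :
    IsOptimal G F L₀ (L ∘ Equiv.swap e f) := by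
  have hmem : ∀ x, Equiv.swap e f x ∈ F ↔ x ∈ F := by
    intro x
    rcases eq_or_ne x e with rfl | h1
    · simp [he, hf]
    rcases eq_or_ne x f with rfl | h2
    · simp [he, hf]
    rw [Equiv.swap_apply_of_ne_of_ne h1 h2]
  refine ⟨⟨?_, ?_⟩, ?_⟩
  -- Among the edges touching `e`, only `f` had the color that `e` receives, and `f` gives it up. So
  -- no conflict arises at `e`.
  · have hside : ∀ a b d, G.Adj b d → a ≠ d → ∀ i, s(a, b) = e →
        (L ∘ Equiv.swap e f) s(a, b) = some i → (L ∘ Equiv.swap e f) s(b, d) ≠ some i := by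
      intro a b d hbd had i hab h1 h2
      simp only [Function.comp] at h1 h2
      have hne : s(b, d) ≠ e := by
        rw [← hab]
        intro h
        rw [Sym2.eq_swap, Sym2.congr_left] at h
        exact had h.symm
      by_cases h3 : s(b, d) = f
      · rw [h3, Equiv.swap_apply_right, hw] at h2
        cases h2
      rw [hab, Equiv.swap_apply_left] at h1
      rw [Equiv.swap_apply_of_ne_of_ne hne h3] at h2
      exact h3 (ht.inj _ _ ⟨hbd, hne, b, by simp [← hab], by simp⟩ hef (h2.trans h1.symm))
    intro a b d hab hbd had hnad i ⟨h1, h2⟩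
    by_cases e1 : s(a, b) = e
    · exact hside a b d hbd had i e1 h1 h2
    by_cases e2 : s(b, d) = e
    · rw [Sym2.eq_swap] at h1 h2 e2
      exact hside d b a hab.symm had.symm i e2 h2 h1
    simp only [Function.comp] at h1 h2
    have e3 : s(a, b) ≠ f := by
      intro h
      rw [h, Equiv.swap_apply_right, hw] at h1
      cases h1
    have e4 : s(b, d) ≠ f := by
      intro h
      rw [h, Equiv.swap_apply_right, hw] at h2
      cases h2
    rw [Equiv.swap_apply_of_ne_of_ne e1 e3] at h1
    rw [Equiv.swap_apply_of_ne_of_ne e2 e4] at h2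
    exact hL.stc a b d hab hbd had hnad i ⟨h1, h2⟩
  · intro x hx
    rw [Function.comp, Equiv.swap_apply_of_ne_of_ne (fun h : x = e => hx (h ▸ he))
      (fun h : x = f => hx (h ▸ hf))]
    exact hL.agree x hx
  · intro L' hL'
    refine le_trans (le_of_eq ?_) (hL.min L' hL')
    have : {x | x ∈ F ∧ (L ∘ Equiv.swap e f) x = none} =
        Equiv.swap e f '' {x | x ∈ F ∧ L x = none} := by
      ext x
      constructor
      · rintro ⟨h1, h2⟩
        exact ⟨Equiv.swap e f x, ⟨(hmem x).2 h1, h2⟩, Equiv.swap_apply_self _ _ _⟩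
      · rintro ⟨y, ⟨h1, h2⟩, rfl⟩
        exact ⟨(hmem y).2 h1, by simpa [Function.comp] using h2⟩
    rw [this, Set.ncard_image_of_injective _ (Equiv.injective _)]

omit [Fintype V] in
/-- After a weak edge has moved along a path of edges, each edge of the path has the color of its
successor. -/
theorem IsOptimal.exists_move_path {G : SimpleGraph V} {F : Set (Sym2 V)}
    {L₀ L : Sym2 V → Option (Fin c)}
    (htight : ∀ L', IsOptimal G F L₀ L' → ∀ e ∈ F, L' e = none → IsTight G L' e)
    (hL : IsOptimal G F L₀ L) {e : ℕ → Sym2 V} {q : ℕ} (heF : ∀ j ≤ q, e j ∈ F)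
    (hinj : Set.InjOn e {j | j ≤ q}) (hadj : ∀ j < q, Touches G (e j) (e (j + 1)))
    (hw : L (e 0) = none) :
    ∃ L', IsOptimal G F L₀ L' ∧ L' (e q) = none ∧ (∀ j < q, L' (e j) = L (e (j + 1))) ∧
      ∀ x, (∀ j ≤ q, x ≠ e j) → L' x = L x := by
  classical
  induction q with
  | zero => exact ⟨L, hL, hw, by simp, fun _ _ => rfl⟩
  | succ q ih =>
    obtain ⟨L', h1, h2, h3, h4⟩ := ih (fun j hj => heF j (by omega))
      (hinj.mono (fun j hj => by simp only [Set.mem_ofPred_eq] at hj ⊢; omega))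
      (fun j hj => hadj j (by omega))
    have hne : ∀ i ≤ q + 1, ∀ j ≤ q + 1, i ≠ j → e i ≠ e j :=
      fun i hi j hj hij h => hij (hinj hi hj h)
    have hold : L' (e (q + 1)) = L (e (q + 1)) :=
      h4 _ (fun j hj => hne _ le_rfl _ (by omega) (by omega))
    refine ⟨L' ∘ Equiv.swap (e q) (e (q + 1)), h1.move (heF q (by omega)) (heF _ le_rfl) h2
      (htight L' h1 _ (heF q (by omega)) h2) (hadj q (by omega)), ?_, ?_, ?_⟩
    · simp [h2]
    · intro j hj
      rcases Nat.lt_succ_iff_lt_or_eq.1 hj with hj | rfl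
      · rw [Function.comp, Equiv.swap_apply_of_ne_of_ne (hne _ (by omega) _ (by omega) (by omega))
          (hne _ (by omega) _ (by omega) (by omega)), h3 j hj]
      · simp [hold]
    · intro x hx
      rw [Function.comp, Equiv.swap_apply_of_ne_of_ne (hx q (by omega)) (hx _ le_rfl)]
      exact h4 x (fun j hj => hx j (by omega))

omit [Fintype V] in
/-- If the edges of a cycle may be weak, then the color alternates around an edge that is weak. -/
theorem IsOptimal.color_eq_of_cycle {G : SimpleGraph V} {F : Set (Sym2 V)}
    {L₀ L : Sym2 V → Option (Fin c)} (hFE : F ⊆ G.edgeSet)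
    (htight : ∀ L', IsOptimal G F L₀ L' → ∀ e ∈ F, L' e = none → IsTight G L' e)
    (hL : IsOptimal G F L₀ L) {e : ℕ → Sym2 V} {q : ℕ} (hq : 3 ≤ q) (heF : ∀ j ≤ q, e j ∈ F)
    (hinj : Set.InjOn e {j | j ≤ q}) (hadj : ∀ j < q, Touches G (e j) (e (j + 1)))
    (hclose : Touches G (e 0) (e q)) (hnot : ∀ j, 2 ≤ j → j < q → ¬ Touches G (e 0) (e j))
    (hw : L (e 0) = none) : L (e 2) = L (e q) := by
  classical
  have hne : ∀ i ≤ q, ∀ j ≤ q, i ≠ j → e i ≠ e j :=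
    fun i hi j hj hij h => hij (hinj hi hj h)
  -- the weak edge at `e 1`
  obtain ⟨L₁, h1, h2, h3, h4⟩ := hL.exists_move_path (q := 1) htight (fun j hj => heF j (by omega))
    (hinj.mono (fun j hj => by simp only [Set.mem_ofPred_eq] at hj ⊢; omega))
    (fun j hj => hadj j (by omega)) hw
  have t1 := htight L₁ h1 _ (heF 1 (by omega)) h2
  have e2 : L₁ (e 2) = L (e 2) := h4 _ (fun j hj => hne _ (by omega) _ (by omega) (by omega))
  have hT12 : Touches G (e 1) (e 2) := hadj 1 (by omega)
  have hT10 : Touches G (e 1) (e 0) := (hadj 0 (by omega)).symm (hFE (heF 0 (by omega)))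
  have hnn : L (e 2) ≠ none := e2 ▸ t1.ne_none _ hT12
  -- With the weak edge at `e 1`, the edge `e 0` wears the old color of `e 1`, and tightness
  -- separates it from `e 2`.
  have h12 : L (e 1) ≠ L (e 2) := by
    intro h
    refine hne 0 (by omega) 2 (by omega) (by omega) (t1.inj _ _ hT10 hT12 ?_)
    rw [e2, h3 0 (by omega), h]
  obtain ⟨i, hi⟩ := Option.ne_none_iff_exists'.1 hnn
  -- Some edge `x` at `e 0` has the color of `e 2`. If it is not `e q`, it lies off the cycle. A
  -- full turn of the weak edge then shifts the color of `e 2` to `e 1` and leaves `x` alone, so two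
  -- edges touching the weak edge agree.
  obtain ⟨x, hx, hxi⟩ := (htight L hL _ (heF 0 (by omega)) hw).surj i
  by_cases hxq : x = e q
  · rw [hi, ← hxi, hxq]
  exfalso
  obtain ⟨L₂, k1, k2, k3, k4⟩ := hL.exists_move_path htight heF hinj hadj hw
  have tq := htight L₂ k1 _ (heF q le_rfl) k2
  have k5 := k1.move (heF q le_rfl) (heF 0 (by omega)) k2 tq
    (hclose.symm (hFE (heF 0 (by omega))))
  set L₃ := L₂ ∘ Equiv.swap (e q) (e 0)
  have k6 : L₃ (e 0) = none := by simp [L₃, k2]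
  have t0 := htight L₃ k5 _ (heF 0 (by omega)) k6
  have hx1 : x ≠ e 1 := fun h => h12 (by rw [hi, ← hxi, h])
  have hxj : ∀ j ≤ q, x ≠ e j := by
    intro j hj h
    rcases Nat.lt_or_ge j 2 with hj2 | hj2
    · interval_cases j
      · exact hx.2.1 h
      · exact hx1 h
    · rcases Nat.lt_or_ge j q with hjq | hjq
      · exact hnot j hj2 hjq (h ▸ hx)
      · exact hxq (by rw [h, le_antisymm hj hjq])
  have a1 : L₃ x = L x := by
    rw [← k4 x hxj]
    simp only [L₃, Function.comp]
    rw [Equiv.swap_apply_of_ne_of_ne (hxj q le_rfl) (hxj 0 (by omega))]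
  have a2 : L₃ (e 1) = L (e 2) := by
    rw [← k3 1 (by omega)]
    simp only [L₃, Function.comp]
    rw [Equiv.swap_apply_of_ne_of_ne (hne _ (by omega) _ (by omega) (by omega))
      (hne _ (by omega) _ (by omega) (by omega))]
  exact hx1 (t0.inj _ _ hx (hadj 0 (by omega)) (by rw [a1, a2, hxi, hi]))

omit [Fintype V] in
/-- A cycle with one more edge at one of its vertices contains no edge that has to be weak. -/
theorem IsOptimal.not_weak_of_cycle {G : SimpleGraph V} {F : Set (Sym2 V)}
    {L₀ L : Sym2 V → Option (Fin c)} (hFE : F ⊆ G.edgeSet)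
    (htight : ∀ L', IsOptimal G F L₀ L' → ∀ e ∈ F, L' e = none → IsTight G L' e)
    (hL : IsOptimal G F L₀ L) {e : ℕ → Sym2 V} {q : ℕ} (hq : 3 ≤ q) (heF : ∀ j ≤ q, e j ∈ F)
    (hinj : Set.InjOn e {j | j ≤ q}) (hadj : ∀ j < q, Touches G (e j) (e (j + 1)))
    (hclose : Touches G (e 0) (e q)) (hnot : ∀ j, 2 ≤ j → j < q → ¬ Touches G (e 0) (e j))
    {f : Sym2 V} (hf : f ∈ F) (hf0 : Touches G (e 0) f) (hfq : Touches G f (e q))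
    (hf2 : f ≠ e 2) : L (e 0) ≠ none := by
  classical
  intro hw
  have hne : ∀ i ≤ q, ∀ j ≤ q, i ≠ j → e i ≠ e j :=
    fun i hi j hj hij h => hij (hinj hi hj h)
  have h0 := heF 0 (by omega)
  have hqF := heF q le_rfl
  have n1 : f ≠ e 0 := hf0.2.1
  have n2 : e q ≠ f := hfq.2.1
  have n3 : e q ≠ e 0 := hclose.2.1
  have n4 : e 2 ≠ e 0 := hne _ (by omega) _ (by omega) (by omega)
  have n5 : e 2 ≠ e q := hne _ (by omega) _ (by omega) (by omega)
  have rot := hL.color_eq_of_cycle hFE htight hq heF hinj hadj hclose hnot hw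
  have t0 := htight L hL _ h0 hw
  -- The closed walk `e 0`, `f`, `e q`, `e 0` of the weak edge exchanges the colors of `f` and `e q`
  -- and does not affect `e 2`. The cycle relation before and after it gives `f` and `e q` the same
  -- color.
  have m1 := hL.move h0 hf hw t0 hf0
  have w1 : (L ∘ Equiv.swap (e 0) f) f = none := by simp [hw]
  have m2 := m1.move hf hqF w1 (htight _ m1 _ hf w1) hfq
  have w2 : ((L ∘ Equiv.swap (e 0) f) ∘ Equiv.swap f (e q)) (e q) = none := by simp [hw]
  have m3 := m2.move hqF h0 w2 (htight _ m2 _ hqF w2) (hclose.symm (hFE h0))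
  have w3 : (((L ∘ Equiv.swap (e 0) f) ∘ Equiv.swap f (e q)) ∘ Equiv.swap (e q) (e 0)) (e 0)
    = none := by simp [hw]
  have rot' := m3.color_eq_of_cycle hFE htight hq heF hinj hadj hclose hnot w3
  simp only [Function.comp, Equiv.swap_apply_left] at rot'
  rw [Equiv.swap_apply_of_ne_of_ne n5 n4, Equiv.swap_apply_of_ne_of_ne hf2.symm n5,
    Equiv.swap_apply_of_ne_of_ne n4 hf2.symm, Equiv.swap_apply_of_ne_of_ne n1.symm n3.symm,
    Equiv.swap_apply_left, rot] at rot'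
  exact n2 (t0.inj _ _ hclose hf0 rot')

end Completion

/-! ### Extending a labeling from the kernel to the whole graph -/

section Extension

variable {V : Type*} [Fintype V] {c : ℕ}

/-- The edges between vertices of degree at most `t`. -/
noncomputable def lowGraph (G : SimpleGraph V) (t : ℕ) : SimpleGraph V where
  Adj u v := G.Adj u v ∧ (nbhd G u).card ≤ t ∧ (nbhd G v).card ≤ t
  symm := ⟨fun _ _ h => ⟨h.1.symm, h.2.2, h.2.1⟩⟩
  loopless := ⟨fun _ h => h.1.ne rfl⟩

theorem lowGraph_adj {G : SimpleGraph V} {t : ℕ} {u v : V} : (lowGraph G t).Adj u v ↔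
    G.Adj u v ∧ (nbhd G u).card ≤ t ∧ (nbhd G v).card ≤ t := Iff.rfl

/-- The edges of those components of the low graph that are not contained in `K`. -/
def freeEdges (G : SimpleGraph V) (t : ℕ) (K : Set V) : Set (Sym2 V) :=
  {e | e ∈ (lowGraph G t).edgeSet ∧ ∃ u ∈ e, ∃ a ∉ K, (lowGraph G t).Reachable u a}

theorem freeEdges_subset {G : SimpleGraph V} {t : ℕ} {K : Set V} :
    freeEdges G t K ⊆ G.edgeSet := by
  rintro ⟨u, v⟩ ⟨h, -⟩
  exact h.1

theorem mk_mem_freeEdges {G : SimpleGraph V} {t : ℕ} {K : Set V} {u v : V} :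
    s(u, v) ∈ freeEdges G t K ↔
      (lowGraph G t).Adj u v ∧ ∃ a ∉ K, (lowGraph G t).Reachable u a := by
  constructor
  · rintro ⟨h, w, hw, a, ha, hwa⟩
    refine ⟨h, a, ha, ?_⟩
    rcases Sym2.mem_iff.1 hw with rfl | rfl
    · exact hwa
    · exact (SimpleGraph.Adj.reachable h).trans hwa
  · rintro ⟨h, h'⟩
    exact ⟨h, u, by simp, h'⟩

theorem exists_maximal_path {W : Type*} [Fintype W] (H : SimpleGraph W) (D : Set W) {a : W}
    (ha : a ∉ D) :
    ∃ (b : W) (p : H.Walk a b), p.IsPath ∧ (∀ x ∈ p.support, x ∉ D) ∧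
      ∀ x, H.Adj b x → x ∉ D → x ∈ p.support := by
  classical
  have hbd : ∀ N, (∃ (b : W) (p : H.Walk a b), (p.IsPath ∧ ∀ x ∈ p.support, x ∉ D) ∧
      p.length = N) → N ≤ Fintype.card W := by
    rintro N ⟨b, p, ⟨hp, -⟩, rfl⟩
    exact hp.length_lt.le
  have hex : ∃ N, ∃ (b : W) (p : H.Walk a b), (p.IsPath ∧ ∀ x ∈ p.support, x ∉ D) ∧
      p.length = N := ⟨0, a, SimpleGraph.Walk.nil, ⟨by simp, by simpa using ha⟩, rfl⟩
  obtain ⟨N0, h0⟩ := hex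
  have hspec := Nat.findGreatest_spec (P := fun N => ∃ (b : W) (p : H.Walk a b),
    (p.IsPath ∧ ∀ x ∈ p.support, x ∉ D) ∧ p.length = N) (hbd N0 h0) h0
  obtain ⟨b, p, ⟨hp, hD⟩, hlen⟩ := hspec
  refine ⟨b, p, hp, hD, fun x hx hxD => ?_⟩
  by_contra hxp
  have hp' : (p.concat hx).IsPath := hp.concat hxp hx
  have h1 : ∃ (b' : W) (p' : H.Walk a b'), (p'.IsPath ∧ ∀ x ∈ p'.support, x ∉ D) ∧
      p'.length = (p.concat hx).length := by
    refine ⟨x, p.concat hx, ⟨hp', fun y hy => ?_⟩, rfl⟩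
    rw [SimpleGraph.Walk.support_concat] at hy
    rcases List.mem_append.1 hy with h | h
    · exact hD y h
    · rw [List.mem_singleton.1 h]
      exact hxD
  have h2 := Nat.le_findGreatest (P := fun N => ∃ (b : W) (p : H.Walk a b),
    (p.IsPath ∧ ∀ x ∈ p.support, x ∉ D) ∧ p.length = N) (hbd _ h1) h1
  rw [← hlen, SimpleGraph.Walk.length_concat] at h2
  omega

/-- The situation in which all free edges can be strong: either the number of colors is that large
that each low edge can be colored greedily, or this holds up to one color and each vertex of degree
`t` outside of `D` has at least two low neighbors outside of `D`. -/
def IsReduced (G : SimpleGraph V) (c t : ℕ) (D : Set V) : Prop :=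
  2 * (t - 1) < c ∨ (2 * (t - 1) = c ∧ 3 ≤ t ∧ ∀ u ∉ D, (nbhd G u).card = t →
    ∃ v w, v ≠ w ∧ (lowGraph G t).Adj u v ∧ (lowGraph G t).Adj u w ∧ v ∉ D ∧ w ∉ D)

/-- A weak free edge could be moved all over its low component, in particular to a vertex `a ∉ K`.
In a longest low path from `a` that avoids `D`, the last vertex has two neighbors outside `D`, both
on the path. This closes a cycle with a further edge at its first vertex, which is impossible. Whole
components are relabeled because the cycle may pass through `K`. -/
theorem IsOptimal.strong_of_isReduced {G : SimpleGraph V} {t : ℕ} {K D : Set V}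
    {L₀ L : Sym2 V → Option (Fin c)} (hred : IsReduced G c t D) (hDK : D ⊆ K)
    (hK : ∀ u v, G.Adj u v → t < (nbhd G u).card → u ∈ K ∧ v ∈ K)
    (hL : IsOptimal G (freeEdges G t K) L₀ L) {e : Sym2 V} (he : e ∈ freeEdges G t K) :
    L e ≠ none := by
  classical
  intro hw
  have hct : 2 * (t - 1) ≤ c := by
    rcases hred with h | h <;> omega
  have hsharp : ∀ L', IsOptimal G (freeEdges G t K) L₀ L' → ∀ u v,
      s(u, v) ∈ freeEdges G t K → L' s(u, v) = none → 2 * (t - 1) = c ∧ (nbhd G u).card = t ∧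
        IsTight G L' s(u, v) ∧ ∀ w, G.Adj u w → ¬ G.Adj v w := by
    intro L' hL' u v huv hw'
    have h := (mk_mem_freeEdges.1 huv).1
    exact hL'.tight h.1 huv h.2.1 h.2.2 hct hw'
  have htight : ∀ L', IsOptimal G (freeEdges G t K) L₀ L' → ∀ e ∈ freeEdges G t K, L' e = none →
      IsTight G L' e := by
    rintro L' hL' ⟨u, v⟩ huv hw'
    exact (hsharp L' hL' u v huv hw').2.2.1
  -- The vertices that the weak edge can reach. They all have degree `t`, and they are closed under
  -- low adjacency.
  set M : V → Prop := fun u => ∃ b L', s(u, b) ∈ freeEdges G t K ∧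
    IsOptimal G (freeEdges G t K) L₀ L' ∧ L' s(u, b) = none with hM
  have hspread : ∀ u, M u → ∀ b, (lowGraph G t).Adj u b → s(u, b) ∈ freeEdges G t K ∧
      ∃ L', IsOptimal G (freeEdges G t K) L₀ L' ∧ L' s(u, b) = none := by
    rintro u ⟨b, L', hub, hL', hw'⟩ d hud
    have hd : s(u, d) ∈ freeEdges G t K := mk_mem_freeEdges.2 ⟨hud, (mk_mem_freeEdges.1 hub).2⟩
    refine ⟨hd, ?_⟩
    by_cases hbd : d = b
    · exact ⟨L', hL', hbd ▸ hw'⟩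
    · refine ⟨_, hL'.move hub hd hw' (htight L' hL' _ hub hw') ⟨freeEdges_subset hd, ?_, u, by simp,
        by simp⟩, by simp [hw']⟩
      intro h
      exact hbd (Sym2.congr_right.1 h)
  have hstep : ∀ u v, M u → (lowGraph G t).Adj u v → M v := by
    intro u v hu huv
    obtain ⟨h, L', hL', hw'⟩ := hspread u hu v huv
    exact ⟨u, L', by rwa [Sym2.eq_swap], hL', by rwa [Sym2.eq_swap]⟩
  have hreach : ∀ u v, (lowGraph G t).Reachable u v → M u → M v := by
    rintro u v ⟨p⟩ hu
    induction p with
    | nil => exact hu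
    | cons h _ ih => exact ih (hstep _ _ hu h)
  obtain ⟨a, haK, hMa⟩ : ∃ a ∉ K, M a := by
    induction e with
    | _ u v =>
      obtain ⟨-, a, ha, hua⟩ := mk_mem_freeEdges.1 he
      exact ⟨a, ha, hreach u a hua ⟨v, L, he, hL, hw⟩⟩
  have hMdeg : ∀ u, M u → 2 * (t - 1) = c ∧ (nbhd G u).card = t := by
    rintro u ⟨b, L', h1, h2, h3⟩
    have := hsharp L' h2 u b h1 h3
    exact ⟨this.1, this.2.1⟩
  obtain ⟨ht3, hD⟩ : 3 ≤ t ∧ ∀ u ∉ D, (nbhd G u).card = t →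
      ∃ v w, v ≠ w ∧ (lowGraph G t).Adj u v ∧ (lowGraph G t).Adj u w ∧ v ∉ D ∧ w ∉ D := by
    rcases hred with h | h
    · have := (hMdeg a hMa).1
      omega
    · exact h.2
  obtain ⟨b, p, hp, hpD, hmax⟩ := exists_maximal_path (lowGraph G t) D (fun h => haK (hDK h))
  have hMp : ∀ i, M (p.getVert i) := fun i => hreach a _ ⟨p.take i⟩ hMa
  -- a cycle
  obtain ⟨i, hi, hib⟩ : ∃ i, i + 2 ≤ p.length ∧ (lowGraph G t).Adj (p.getVert i) b := by
    have hMb : M b := by simpa using hMp p.length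
    obtain ⟨v, w, hvw, hv, hw', hvD, hwD⟩ := hD b (hpD b (by simp)) (hMdeg b hMb).2
    obtain ⟨i, hi1, hi2⟩ := SimpleGraph.Walk.mem_support_iff_exists_getVert.1 (hmax v hv hvD)
    obtain ⟨j, hj1, hj2⟩ := SimpleGraph.Walk.mem_support_iff_exists_getVert.1 (hmax w hw' hwD)
    have hil : i ≠ p.length := by
      rintro rfl
      rw [SimpleGraph.Walk.getVert_length] at hi1
      exact hv.ne hi1
    have hjl : j ≠ p.length := by
      rintro rfl
      rw [SimpleGraph.Walk.getVert_length] at hj1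
      exact hw'.ne hj1
    have hij : i ≠ j := by
      rintro rfl
      exact hvw (hi1.symm.trans hj1)
    -- Both positions precede the last one and they differ, so at most one of them is next to the
    -- end.
    by_cases h : i + 2 ≤ p.length
    · exact ⟨i, h, by rw [hi1]; exact hv.symm⟩
    · exact ⟨j, by omega, by rw [hj1]; exact hw'.symm⟩
  set q := p.length - i with hq
  set z : ℕ → V := fun j => p.getVert (i + j) with hz
  have zinj : ∀ j ≤ q, ∀ k ≤ q, z j = z k → j = k := by
    intro j hj k hk h
    have := hp.getVert_injOn (show i + j ∈ {n | n ≤ p.length} by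
      rw [Set.mem_ofPred_eq]; omega) (show i + k ∈ {n | n ≤ p.length} by
      rw [Set.mem_ofPred_eq]; omega) h
    omega
  have zq : z q = b := by
    simp only [hz, hq]
    rw [Nat.add_sub_cancel' (by omega)]
    simp
  have zadj : ∀ j < q, (lowGraph G t).Adj (z j) (z (j + 1)) := by
    intro j hj
    exact p.adj_getVert_succ (by omega)
  have zclose : (lowGraph G t).Adj (z 0) (z q) := by
    rw [zq]
    exact hib
  have hMz : ∀ j, M (z j) := fun j => hMp _
  have hq2 : 2 ≤ q := by omega
  -- A triangle is excluded since the endpoints of a tight edge have no common neighbor.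
  have hq3 : 3 ≤ q := by
    by_contra h
    have hqe : q = 2 := by omega
    obtain ⟨h1, L', h2, h3⟩ := hspread _ (hMz 0) _ (zadj 0 (by omega))
    refine (hsharp L' h2 _ _ h1 h3).2.2.2 (z 2) ?_ (zadj 1 (by omega)).1
    rw [← hqe]
    exact zclose.1
  -- The extra edge at `z 0` is the path edge that leads into the cycle. If the cycle starts at `a`
  -- itself, it is a third edge at `a`, which is low because a vertex outside `K` has no high
  -- neighbor.
  obtain ⟨y, hy, hy1, hyq⟩ : ∃ y, (lowGraph G t).Adj (z 0) y ∧ y ≠ z 1 ∧ y ≠ z q := by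
    rcases Nat.eq_zero_or_pos i with hi0 | hi0
    · have hz0 : z 0 = a := by simp [hz, hi0]
      have hcard : 2 < (nbhd G a).card := by
        rw [(hMdeg a hMa).2]; omega
      have hle : ({z 1, z q} : Finset V).card ≤ 2 := Finset.card_le_two
      obtain ⟨y, hy, hyn⟩ := Finset.exists_mem_notMem_of_card_lt_card (hle.trans_lt hcard)
      simp only [Finset.mem_insert, Finset.mem_singleton, not_or] at hyn
      rw [mem_nbhd] at hy
      refine ⟨y, ?_, hyn.1, hyn.2⟩
      rw [hz0]
      refine ⟨hy, (hMdeg a hMa).2.le, ?_⟩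
      by_contra hlt
      exact haK (hK y a hy.symm (not_le.1 hlt)).2
    · refine ⟨p.getVert (i - 1), ?_, ?_, ?_⟩
      · have := p.adj_getVert_succ (i := i - 1) (by omega)
        rw [Nat.sub_add_cancel hi0] at this
        exact this.symm
      · intro h
        have := hp.getVert_injOn (show i - 1 ∈ {n | n ≤ p.length} by
          rw [Set.mem_ofPred_eq]; omega) (show i + 1 ∈ {n | n ≤ p.length} by
          rw [Set.mem_ofPred_eq]; omega) h
        omega
      · intro h
        have := hp.getVert_injOn (show i - 1 ∈ {n | n ≤ p.length} by
          rw [Set.mem_ofPred_eq]; omega) (show i + q ∈ {n | n ≤ p.length} by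
          rw [Set.mem_ofPred_eq]; omega) h
        omega
  -- The edges of the cycle in order, with the closing edge at index `q`.
  set ed : ℕ → Sym2 V := fun j => if j < q then s(z j, z (j + 1)) else s(z 0, z q) with hed
  have ed_lt : ∀ j < q, ed j = s(z j, z (j + 1)) := fun j hj => by simp [hed, hj]
  have ed_q : ed q = s(z 0, z q) := by simp [hed]
  have edF : ∀ j ≤ q, ed j ∈ freeEdges G t K := by
    intro j hj
    rcases hj.lt_or_eq with h | rfl
    · rw [ed_lt j h]
      exact (hspread _ (hMz j) _ (zadj j h)).1
    · rw [ed_q]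
      exact (hspread _ (hMz 0) _ zclose).1
  have zne : ∀ j ≤ q, ∀ k ≤ q, j ≠ k → z j ≠ z k := fun j hj k hk hjk h => hjk (zinj j hj k hk h)
  have edinj : Set.InjOn ed {j | j ≤ q} := by
    intro j hj k hk hjk
    rw [Set.mem_ofPred_eq] at hj hk
    rcases hj.lt_or_eq with h | rfl <;> rcases hk.lt_or_eq with h' | rfl
    · rw [ed_lt j h, ed_lt k h'] at hjk
      rcases Sym2.eq_iff.1 hjk with ⟨h1, -⟩ | ⟨h1, h2⟩
      · exact zinj j hj k hk h1
      · have := zinj j hj _ (by omega) h1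
        have := zinj _ (by omega) k hk h2
        omega
    · rw [ed_lt j h, ed_q] at hjk
      rcases Sym2.eq_iff.1 hjk with ⟨h1, h2⟩ | ⟨h1, h2⟩
      · have := zinj j hj _ (by omega) h1
        have := zinj _ (by omega) _ (by omega) h2
        omega
      · have := zinj j hj _ (by omega) h1
        omega
    · rw [ed_lt k h', ed_q] at hjk
      rcases Sym2.eq_iff.1 hjk with ⟨h1, h2⟩ | ⟨h1, h2⟩
      · have := zinj _ (by omega) k hk h1
        have := zinj _ (by omega) _ (by omega) h2
        omega
      · have := zinj _ (by omega) k hk h2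
        omega
    · rfl
  have edadj : ∀ j < q, Touches G (ed j) (ed (j + 1)) := by
    intro j hj
    refine ⟨freeEdges_subset (edF _ (by omega)), fun h => ?_, z (j + 1), ?_, ?_⟩
    · have := edinj (show j + 1 ∈ {n | n ≤ q} by rw [Set.mem_ofPred_eq]; omega)
        (show j ∈ {n | n ≤ q} by rw [Set.mem_ofPred_eq]; omega) h
      omega
    · rw [ed_lt j hj]; simp
    · rcases Nat.lt_or_ge (j + 1) q with h | h
      · rw [ed_lt _ h]; simp
      · rw [show j + 1 = q by omega, ed_q]; simp
  have ed0 := ed_lt 0 (by omega)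
  have hne0q : ed q ≠ ed 0 := fun h => by
    have := edinj (show q ∈ {n | n ≤ q} by rw [Set.mem_ofPred_eq])
      (show 0 ∈ {n | n ≤ q} by rw [Set.mem_ofPred_eq]; omega) h
    omega
  have hf := (hspread _ (hMz 0) _ hy).1
  obtain ⟨-, L', hL', hw'⟩ := hspread _ (hMz 0) _ (zadj 0 (by omega))
  refine hL'.not_weak_of_cycle freeEdges_subset htight hq3 edF edinj edadj
    ⟨freeEdges_subset (edF q le_rfl), hne0q, z 0, by rw [ed0]; simp, by rw [ed_q]; simp⟩ ?_ hf
    ⟨freeEdges_subset hf, ?_, z 0, by rw [ed0]; simp, by simp⟩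
    ⟨freeEdges_subset (edF q le_rfl), ?_, z 0, by simp, by rw [ed_q]; simp⟩ ?_ (by rw [ed0]; exact hw')
  · rintro j hj2 hjq ⟨-, -, x, hx, hxj⟩
    rw [ed0] at hx
    rw [ed_lt j hjq] at hxj
    rcases Sym2.mem_iff.1 hx with rfl | rfl <;> rcases Sym2.mem_iff.1 hxj with h | h <;>
      · have := zinj _ (by omega) _ (by omega) h
        omega
  · rw [ed0]
    exact fun h => hy1 (Sym2.congr_right.1 h)
  · rw [ed_q]
    exact fun h => hyq (Sym2.congr_right.1 h).symm
  · rw [ed_lt 2 (by omega)]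
    intro h
    rcases Sym2.eq_iff.1 h with ⟨h1, -⟩ | ⟨h1, -⟩
    · exact absurd (zinj _ (by omega) _ (by omega) h1) (by omega)
    · exact absurd (zinj _ (by omega) _ (by omega) h1) (by omega)

/-- A labeling of the subgraph that is induced by `K` extends without further weak edges. -/
theorem exists_labeling_iff {V' : Type*} [Finite V'] {G : SimpleGraph V} {t k : ℕ} {D : Set V}
    (φ : V' ↪ V) (hred : IsReduced G c t D) (hDK : D ⊆ Set.range φ)
    (hK : ∀ u v, G.Adj u v → t < (nbhd G u).card → u ∈ Set.range φ ∧ v ∈ Set.range φ) :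
    (∃ L : Sym2 V' → Option (Fin c), IsSTCLabeling (G.comap φ) L ∧
      (weakEdges (G.comap φ) L).ncard ≤ k) ↔
    ∃ L : Sym2 V → Option (Fin c), IsSTCLabeling G L ∧ (weakEdges G L).ncard ≤ k := by
  classical
  have hinj := Sym2.map.injective φ.injective
  constructor
  · rintro ⟨L', hL', hk⟩
    -- All edges outside the kernel start as weak. This is an STC-labeling because the strong edges
    -- lie in an induced subgraph.
    set L₀ : Sym2 V → Option (Fin c) := Function.extend (Sym2.map φ) L' (fun _ => none) with hL₀
    have hL₀map : ∀ e, L₀ (Sym2.map φ e) = L' e := fun e => hinj.extend_apply _ _ _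
    have hL₀some : ∀ e i, L₀ e = some i → ∃ e', Sym2.map φ e' = e := by
      intro e i h
      by_contra hcon
      rw [hL₀, Function.extend_apply' _ _ _ hcon] at h
      cases h
    have hL₀stc : IsSTCLabeling G L₀ := by
      intro u v w huv hvw huw hnuw i ⟨h1, h2⟩
      have range : ∀ x y, L₀ s(x, y) = some i → (∃ x', φ x' = x) ∧ ∃ y', φ y' = y := by
        intro x y h
        obtain ⟨⟨a, b⟩, hab⟩ := hL₀some _ _ h
        rcases Sym2.eq_iff.1 (show s(φ a, φ b) = s(x, y) from hab) with ⟨h1, h2⟩ | ⟨h1, h2⟩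
        · exact ⟨⟨a, h1⟩, ⟨b, h2⟩⟩
        · exact ⟨⟨b, h2⟩, ⟨a, h1⟩⟩
      obtain ⟨⟨u, rfl⟩, ⟨v, rfl⟩⟩ := range _ _ h1
      obtain ⟨-, ⟨w, rfl⟩⟩ := range _ _ h2
      exact hL' u v w huv hvw (fun h => huw (h ▸ rfl)) hnuw i
        ⟨by rw [← h1, ← hL₀map]; rfl, by rw [← h2, ← hL₀map]; rfl⟩
    obtain ⟨L, hL⟩ := exists_isOptimal (F := freeEdges G t (Set.range φ)) hL₀stc
    refine ⟨L, hL.stc, le_trans ?_ hk⟩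
    rw [← Set.ncard_image_of_injective _ hinj]
    refine Set.ncard_le_ncard ?_ (Set.toFinite _)
    rintro ⟨u, v⟩ ⟨hE, hw⟩
    change s(u, v) ∈ G.edgeSet at hE
    change L s(u, v) = none at hw
    rw [SimpleGraph.mem_edgeSet] at hE
    -- A remaining weak edge is not free, so it has kept its label. It also lies inside the kernel,
    -- since an edge with an endpoint outside is low and hence free.
    have hnf : s(u, v) ∉ freeEdges G t (Set.range φ) :=
      fun h => hL.strong_of_isReduced hred hDK hK h hw
    have hrange : u ∈ Set.range φ ∧ v ∈ Set.range φ := by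
      by_cases hu : t < (nbhd G u).card
      · exact hK u v hE hu
      by_cases hv : t < (nbhd G v).card
      · exact (hK v u hE.symm hv).symm
      have hlow : (lowGraph G t).Adj u v := ⟨hE, not_lt.1 hu, not_lt.1 hv⟩
      by_contra hcon
      apply hnf
      rw [not_and_or] at hcon
      rcases hcon with h | h
      · exact mk_mem_freeEdges.2 ⟨hlow, u, h, SimpleGraph.Reachable.refl _⟩
      · exact mk_mem_freeEdges.2 ⟨hlow, v, h, hlow.reachable⟩
    obtain ⟨⟨u, rfl⟩, ⟨v, rfl⟩⟩ := hrange
    refine ⟨s(u, v), ⟨hE, ?_⟩, rfl⟩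
    rw [← hL₀map]
    exact (hL.agree _ hnf).symm.trans hw
  · rintro ⟨L, hL, hk⟩
    refine ⟨L ∘ Sym2.map φ, ?_, le_trans ?_ hk⟩
    · intro u v w huv hvw huw hnuw i h
      exact hL _ _ _ huv hvw (fun h => huw (φ.injective h)) hnuw i h
    · rw [← Set.ncard_image_of_injective _ hinj]
      refine Set.ncard_le_ncard ?_ (Set.toFinite _)
      rintro _ ⟨⟨u, v⟩, ⟨hE, hw⟩, rfl⟩
      exact ⟨hE, hw⟩

end Extension

/-! ### The size of the kernel -/

section Size

variable {V : Type*} [Fintype V]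

/-- `D` arises by repeatedly taking a vertex of `S` with at most one neighbor that has not been taken
before. -/
inductive IsPeeled [DecidableEq V] (H : SimpleGraph V) (S : Set V) : Finset V → Prop
  | empty : IsPeeled H S ∅
  | step {D : Finset V} {u : V} (hD : IsPeeled H S D) (hu : u ∉ D) (huS : u ∈ S)
      (h : (nbhd H u \ D).card ≤ 1) : IsPeeled H S (insert u D)

theorem IsPeeled.subset [DecidableEq V] {H : SimpleGraph V} {S : Set V} {D : Finset V}
    (h : IsPeeled H S D) : ∀ v ∈ D, v ∈ S := by
  induction h with
  | empty => simp
  | step hD hu huS h ih =>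
    intro v hv
    rcases Finset.mem_insert.1 hv with rfl | hv
    · exact huS
    · exact ih v hv

/-- The second sum counts the edges leaving `D` and serves as a potential. Taking `u` adds its
degree, removes the edges from `D` to `u` and adds those from `u` to the outside. The net gain is
twice the number of untaken neighbors of `u`, hence at most two. -/
theorem IsPeeled.sum_card_le [DecidableEq V] {H : SimpleGraph V} {S : Set V} {D : Finset V}
    (h : IsPeeled H S D) :
    ∑ v ∈ D, (nbhd H v).card + ∑ v ∈ D, (nbhd H v \ D).card ≤ 2 * D.card := by
  induction h with
  | empty => simp
  | @step D u hD hu huS h ih =>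
    rw [Finset.sum_insert hu, Finset.sum_insert hu, Finset.card_insert_of_notMem hu]
    have h1 : ∑ v ∈ D, (nbhd H v \ D).card =
        ∑ v ∈ D, (nbhd H v \ insert u D).card + (nbhd H u ∩ D).card := by
      rw [Finset.card_eq_sum_ones (nbhd H u ∩ D), Finset.inter_comm, ← Finset.filter_mem_eq_inter,
        Finset.sum_filter, ← Finset.sum_add_distrib]
      refine Finset.sum_congr rfl fun v hv => ?_
      split_ifs with hvu
      · have hmem : u ∈ nbhd H v \ D :=
          Finset.mem_sdiff.2 ⟨mem_nbhd.2 (mem_nbhd.1 hvu).symm, hu⟩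
        rw [show nbhd H v \ insert u D = (nbhd H v \ D).erase u by
          ext x; simp only [Finset.mem_sdiff, Finset.mem_insert, Finset.mem_erase]; tauto]
        rw [Finset.card_erase_add_one hmem]
      · have hmem : u ∉ nbhd H v := fun h => hvu (mem_nbhd.2 (mem_nbhd.1 h).symm)
        rw [add_zero]
        congr 1
        ext x
        simp only [Finset.mem_sdiff, Finset.mem_insert]
        refine and_congr_right fun hx => ?_
        have : x ≠ u := fun h => hmem (h ▸ hx)
        tauto
    have h2 : (nbhd H u \ insert u D).card ≤ (nbhd H u \ D).card :=
      Finset.card_le_card (Finset.sdiff_subset_sdiff le_rfl (Finset.subset_insert _ _))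
    have h3 := Finset.card_sdiff_add_card_inter (nbhd H u) D
    omega

theorem exists_isEdgeDeletionSet (G : SimpleGraph V) (t : ℕ) :
    ∃ E : Finset (Sym2 V), IsEdgeDeletionSet G t E ∧ E.card = xi G t := by
  classical
  have hne : {s : ℕ | ∃ D : Finset (Sym2 V), IsEdgeDeletionSet G t D ∧ D.card = s}.Nonempty := by
    refine ⟨_, Finset.univ.filter (· ∈ G.edgeSet), ⟨?_, fun v => ?_⟩, rfl⟩
    · intro e he
      simpa using he
    · rw [show (G.deleteEdges _).neighborSet v = ∅ by
        ext w; simp]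
      simp
  exact Nat.sInf_mem hne

open Classical in
/-- The vertices of degree more than `t`. -/
noncomputable def highVertices (G : SimpleGraph V) (t : ℕ) : Finset V :=
  Finset.univ.filter fun v => t < (nbhd G v).card

/-- The degree of a vertex is at most `t` plus the number `d` of deleted edges there. So `d ≥ 1` at
a high vertex, and its degree is at most `d * (t + 1)`. Each deleted edge is counted at its two
endpoints. -/
theorem sum_card_highVertices_le (G : SimpleGraph V) (t : ℕ) :
    (highVertices G t).card ≤ 2 * xi G t ∧
    ∑ v ∈ highVertices G t, (nbhd G v).card ≤ 2 * xi G t * (t + 1) := by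
  classical
  obtain ⟨E, ⟨hE, hdeg⟩, hcard⟩ := exists_isEdgeDeletionSet G t
  have hle : ∀ v, (nbhd G v).card ≤ t + (E.filter fun e => v ∈ e).card := by
    intro v
    have hsub : nbhd G v ⊆ nbhd (G.deleteEdges (E : Set (Sym2 V))) v ∪
        (Finset.univ.filter fun w => s(v, w) ∈ E) := by
      intro w hw
      rw [mem_nbhd] at hw
      by_cases h : s(v, w) ∈ E
      · exact Finset.mem_union_right _ (by simpa using h)
      · refine Finset.mem_union_left _ ?_
        rw [mem_nbhd, SimpleGraph.deleteEdges_adj]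
        exact ⟨hw, by simpa using h⟩
    refine (Finset.card_le_card hsub).trans ((Finset.card_union_le _ _).trans
      (add_le_add ?_ ?_))
    · refine le_trans (le_of_eq ?_) (hdeg v)
      rw [← Set.ncard_coe_finset]
      congr 1
      ext w
      simp
    · refine Finset.card_le_card_of_injOn (fun w => s(v, w)) ?_ ?_
      · intro w hw
        simpa using hw
      · intro a _ b _ h
        exact Sym2.congr_right.1 h
  have hsum : ∑ v, (E.filter fun e => v ∈ e).card ≤ 2 * xi G t := by
    simp_rw [Finset.card_filter]
    rw [Finset.sum_comm, ← hcard, mul_comm]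
    rw [← smul_eq_mul]
    refine Finset.sum_le_card_nsmul _ _ _ fun e _ => ?_
    induction e with
    | _ a b =>
      rw [← Finset.card_filter]
      refine (Finset.card_le_card ?_).trans (Finset.card_le_two (a := a) (b := b))
      intro x hx
      simpa using hx
  have hhigh : ∀ v ∈ highVertices G t, 1 ≤ (E.filter fun e => v ∈ e).card := by
    intro v hv
    have := hle v
    simp only [highVertices, Finset.mem_filter, Finset.mem_univ, true_and] at hv
    omega
  have hsub : ∑ v ∈ highVertices G t, (E.filter fun e => v ∈ e).card ≤ 2 * xi G t :=
    (Finset.sum_le_sum_of_subset (Finset.subset_univ _)).trans hsum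
  constructor
  · rw [Finset.card_eq_sum_ones]
    exact (Finset.sum_le_sum hhigh).trans hsub
  · calc ∑ v ∈ highVertices G t, (nbhd G v).card
        ≤ ∑ v ∈ highVertices G t, (E.filter fun e => v ∈ e).card * (t + 1) := by
          refine Finset.sum_le_sum fun v hv => ?_
          have h1 := hle v
          have h2 := hhigh v hv
          nlinarith
      _ ≤ 2 * xi G t * (t + 1) := by
          rw [← Finset.sum_mul]
          exact Nat.mul_le_mul_right _ hsub

/-- Vertices of degree `t` consist of low neighbors and of high neighbors. -/
theorem card_nbhd_eq [DecidableEq V] {G : SimpleGraph V} {t : ℕ} {v : V}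
    (hv : (nbhd G v).card = t) :
    t = (nbhd (lowGraph G t) v).card + (nbhd G v ∩ highVertices G t).card := by
  have : nbhd (lowGraph G t) v = nbhd G v \ highVertices G t := by
    ext w
    simp [lowGraph_adj, highVertices, hv]
  rw [this, Finset.card_sdiff_add_card_inter, hv]

/-- For nonempty `D`, comparing `t * D.card` with the low degrees, at most `2 * D.card` in total,
and with the edges to high vertices shows that `t ≥ 3` leaves `D.card` at most the total degree of
the high vertices. The rest of `K` consists of high vertices and their neighbors. Vertices of `K`
that are not high contribute at most `t` each to the degree sum. -/
theorem card_kernel_le [DecidableEq V] {G : SimpleGraph V} {t : ℕ} {D K : Finset V}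
    (hD : IsPeeled (lowGraph G t) {v | (nbhd G v).card = t} D) (hDt : D = ∅ ∨ 3 ≤ t)
    (hK : ∀ v ∈ K, v ∈ D ∨ ∃ w, G.Adj v w ∧ (t < (nbhd G v).card ∨ t < (nbhd G w).card)) :
    K.card ≤ 6 * xi G t * (t + 1) ∧ ∑ v ∈ K, (nbhd G v).card ≤ 8 * xi G t * (t + 1) ^ 2 := by
  obtain ⟨hH1, hH2⟩ := sum_card_highVertices_le G t
  set H := highVertices G t with hHdef
  have hmemH : ∀ v, v ∈ H ↔ t < (nbhd G v).card := fun v => by simp [hHdef, highVertices]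
  have hDcard : D.card ≤ ∑ v ∈ H, (nbhd G v).card := by
    rcases hDt with rfl | ht
    · simp
    have h1 := hD.sum_card_le
    have h2 : D.card * t = ∑ v ∈ D, (nbhd (lowGraph G t) v).card +
        ∑ v ∈ D, (nbhd G v ∩ H).card := by
      rw [← Finset.sum_add_distrib, ← smul_eq_mul, ← Finset.sum_const]
      exact Finset.sum_congr rfl fun v hv => card_nbhd_eq (hD.subset v hv)
    have h3 : ∑ v ∈ D, (nbhd G v ∩ H).card ≤ ∑ v ∈ H, (nbhd G v).card := by
      have e1 : ∀ v, (nbhd G v ∩ H).card = ∑ w ∈ H, if v ∈ nbhd G w then 1 else 0 := by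
        intro v
        rw [← Finset.card_filter]
        congr 1
        ext w
        simp [and_comm, SimpleGraph.adj_comm]
      simp_rw [e1]
      rw [Finset.sum_comm]
      refine Finset.sum_le_sum fun w _ => ?_
      rw [← Finset.card_filter]
      exact Finset.card_le_card fun x hx => (Finset.mem_filter.1 hx).2
    have h4 : D.card * 3 ≤ D.card * t := Nat.mul_le_mul_left _ ht
    omega
  have hKsub : K ⊆ D ∪ (H ∪ H.biUnion (nbhd G)) := by
    intro v hv
    simp only [Finset.mem_union, Finset.mem_biUnion, hmemH]
    rcases hK v hv with h | ⟨w, hw, h | h⟩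
    · exact Or.inl h
    · exact Or.inr (Or.inl h)
    · exact Or.inr (Or.inr ⟨w, h, by simpa using hw.symm⟩)
  have hKcard : K.card ≤ 6 * xi G t * (t + 1) := by
    have h1 := (Finset.card_le_card hKsub).trans (Finset.card_union_le _ _)
    have h2 := Finset.card_union_le H (H.biUnion (nbhd G))
    have h3 : (H.biUnion (nbhd G)).card ≤ ∑ v ∈ H, (nbhd G v).card := Finset.card_biUnion_le
    nlinarith
  refine ⟨hKcard, ?_⟩
  have h1 : ∑ v ∈ K, (nbhd G v).card ≤
      ∑ v ∈ H, (nbhd G v).card + K.card * t := by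
    rw [← Finset.sum_filter_add_sum_filter_not K (· ∈ H)]
    refine add_le_add (Finset.sum_le_sum_of_subset fun v hv => (Finset.mem_filter.1 hv).2) ?_
    calc ∑ v ∈ K.filter (· ∉ H), (nbhd G v).card ≤ (K.filter (· ∉ H)).card * t := by
          rw [← smul_eq_mul]
          refine Finset.sum_le_card_nsmul _ _ _ fun v hv => ?_
          have := (Finset.mem_filter.1 hv).2
          rw [hmemH] at this
          exact not_lt.1 this
      _ ≤ K.card * t := Nat.mul_le_mul_right _ (Finset.card_filter_le _ _)
  have h2 := Nat.mul_le_mul_right t hKcard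
  nlinarith [Nat.zero_le (xi G t * t), Nat.zero_le (xi G t)]

end Size

/-! ### Reasoning about programs -/

section Calculus

/-- Started at time `s` in the memory `σ`, the program terminates at a time and in a memory that
satisfy `Q`. -/
def wp (W : ℕ) (p : Program) (Q : ℕ → Memory → Prop) (s : ℕ) (σ : Memory) : Prop :=
  ∃ t τ, Exec W p σ t τ ∧ Q (s + t) τ

variable {W : ℕ} {Q : ℕ → Memory → Prop} {s : ℕ} {σ : Memory}

theorem wp_const {x v : ℕ} : wp W (.const x v) Q s σ ↔ v ≤ W ∧ Q (s + 1) (σ.setReg x v) := by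
  constructor
  · rintro ⟨t, τ, h, hQ⟩
    cases h
    exact ⟨by assumption, hQ⟩
  · rintro ⟨h, hQ⟩
    exact ⟨_, _, .const _ _ _ h, hQ⟩

theorem wp_arith {op : ArithOp} {x y z : ℕ} : wp W (.arith op x y z) Q s σ ↔
    op.eval (σ.reg y) (σ.reg z) ≤ W ∧
      Q (s + 1) (σ.setReg x (op.eval (σ.reg y) (σ.reg z))) := by
  constructor
  · rintro ⟨t, τ, h, hQ⟩
    cases h
    exact ⟨by assumption, hQ⟩
  · rintro ⟨h, hQ⟩
    exact ⟨_, _, .arith _ _ _ _ _ h, hQ⟩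

theorem wp_load {x a y : ℕ} : wp W (.load x a y) Q s σ ↔
    Q (s + 1) (σ.setReg x (σ.arr a (σ.reg y))) := by
  constructor
  · rintro ⟨t, τ, h, hQ⟩
    cases h
    exact hQ
  · exact fun hQ => ⟨_, _, .load _ _ _ _, hQ⟩

theorem wp_store {a x y : ℕ} : wp W (.store a x y) Q s σ ↔
    Q (s + 1) (σ.setArr a (σ.reg x) (σ.reg y)) := by
  constructor
  · rintro ⟨t, τ, h, hQ⟩
    cases h
    exact hQ
  · exact fun hQ => ⟨_, _, .store _ _ _ _, hQ⟩

theorem wp_seq {p q : Program} : wp W (.seq p q) Q s σ ↔ wp W p (wp W q Q) s σ := by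
  constructor
  · rintro ⟨t, τ, h, hQ⟩
    cases h with
    | seq h₁ h₂ => exact ⟨_, _, h₁, _, _, h₂, by rwa [add_assoc]⟩
  · rintro ⟨t₁, τ, h₁, t₂, ρ, h₂, hQ⟩
    exact ⟨_, _, .seq h₁ h₂, by rwa [← add_assoc]⟩

theorem wp_cond {b : RegTest} {p q : Program} : wp W (.cond b p q) Q s σ ↔
    (b.Holds σ → wp W p Q (s + 1) σ) ∧ (¬ b.Holds σ → wp W q Q (s + 1) σ) := by
  constructor
  · rintro ⟨t, τ, h, hQ⟩
    cases h with
    | @condTrue _ _ _ _ _ t hb h =>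
      exact ⟨fun _ => ⟨t, τ, h, by rwa [add_assoc, add_comm 1]⟩, fun hn => absurd hb hn⟩
    | @condFalse _ _ _ _ _ t hb h =>
      exact ⟨fun hn => absurd hn hb, fun _ => ⟨t, τ, h, by rwa [add_assoc, add_comm 1]⟩⟩
  · rintro ⟨h₁, h₂⟩
    by_cases hb : b.Holds σ
    · obtain ⟨t, τ, h, hQ⟩ := h₁ hb
      exact ⟨_, _, .condTrue hb h, by rwa [add_comm t, ← add_assoc]⟩
    · obtain ⟨t, τ, h, hQ⟩ := h₂ hb
      exact ⟨_, _, .condFalse hb h, by rwa [add_comm t, ← add_assoc]⟩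

theorem wp_mono {p : Program} {Q' : ℕ → Memory → Prop} (h : wp W p Q s σ)
    (hQ : ∀ s τ, Q s τ → Q' s τ) : wp W p Q' s σ := by
  obtain ⟨t, τ, h, h'⟩ := h
  exact ⟨t, τ, h, hQ _ _ h'⟩

/-- The rule for loops. The first argument of the invariant decreases. -/
theorem wp_loop {b : RegTest} {p : Program} (Inv : ℕ → ℕ → Memory → Prop)
    (hstep : ∀ j s σ, Inv j s σ → b.Holds σ →
      wp W p (fun s' τ => ∃ j' < j, Inv j' (s' + 1) τ) s σ)
    (hend : ∀ j s σ, Inv j s σ → ¬ b.Holds σ → Q (s + 1) σ) {j : ℕ} (h : Inv j s σ) :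
    wp W (.loop b p) Q s σ := by
  induction j using Nat.strong_induction_on generalizing s σ with
  | _ j ih =>
    by_cases hb : b.Holds σ
    · obtain ⟨t, τ, h₁, j', hj', h₂⟩ := hstep j s σ h hb
      obtain ⟨t', ρ, h₃, hQ⟩ := ih j' hj' h₂
      refine ⟨_, _, .loopTrue hb h₁ h₃, ?_⟩
      rwa [show s + (t + t' + 1) = s + t + 1 + t' by omega]
    · exact ⟨_, _, .loopFalse hb, hend j s σ h hb⟩

/-- The rule for loops that count the register `x` up to the content `N` of the register `y`. -/
theorem wp_loop_count {x y N : ℕ} {p : Program} (Inv : ℕ → ℕ → Memory → Prop)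
    (hx : ∀ i s σ, Inv i s σ → σ.reg x = i ∧ σ.reg y = N ∧ i ≤ N)
    (hstep : ∀ i s σ, i < N → Inv i s σ → wp W p (fun s' τ => Inv (i + 1) (s' + 1) τ) s σ)
    (hend : ∀ s σ, Inv N s σ → Q (s + 1) σ) (h : Inv 0 s σ) :
    wp W (.loop (.lt x y) p) Q s σ := by
  refine wp_loop (fun j s σ => ∃ i, j + i = N ∧ Inv i s σ) ?_ ?_ (j := N) ⟨0, by omega, h⟩
  · rintro j s σ ⟨i, hi, hI⟩ hb
    obtain ⟨h1, h2, h3⟩ := hx i s σ hI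
    simp only [RegTest.Holds, h1, h2] at hb
    exact wp_mono (hstep i s σ hb hI) fun s' τ h => ⟨j - 1, by omega, i + 1, by omega, h⟩
  · rintro j s σ ⟨i, hi, hI⟩ hb
    obtain ⟨h1, h2, h3⟩ := hx i s σ hI
    simp only [RegTest.Holds, h1, h2] at hb
    have : i = N := by omega
    subst this
    exact hend s σ hI

@[simp] theorem reg_setReg {x v y : ℕ} :
    (σ.setReg x v).reg y = if y = x then v else σ.reg y := by
  simp [Memory.setReg, Function.update_apply]

@[simp] theorem arr_setReg {x v : ℕ} : (σ.setReg x v).arr = σ.arr := rfl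

@[simp] theorem reg_setArr {a i v : ℕ} : (σ.setArr a i v).reg = σ.reg := rfl

@[simp] theorem arr_setArr {a i v b j : ℕ} :
    (σ.setArr a i v).arr b j = if b = a ∧ j = i then v else σ.arr b j := by
  simp only [Memory.setArr, Function.update_apply]
  by_cases h : b = a
  · subst h
    simp [Function.update_apply]
  · simp [h]

end Calculus

infixr:60 " ;; " => Program.seq

/-! ### The program -/

namespace Kernel

/-- Register 9 is scratch space. During the main program register 5 contains 1 and register 12
contains 0. The arrays from 2 on hold the degree, the mark of kept vertices, the number and the sum
modulo `n` of untaken low neighbors, the mark of taken vertices, and the new name. -/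
def skip : Program := .const 9 0

/-- The registers 7 and 8 become the endpoints of the edge with the number in register 6. -/
def loadEdge : Program := .load 7 0 6 ;; .load 8 1 6

def countDegrees : Program :=
  .const 6 0 ;; .loop (.lt 6 1)
    (loadEdge ;;
      .load 9 2 7 ;; .arith .add 9 9 5 ;; .store 2 7 9 ;;
      .load 9 2 8 ;; .arith .add 9 9 5 ;; .store 2 8 9 ;;
      .arith .add 6 6 5)

def markEdge : Program := .store 3 7 5 ;; .store 3 8 5

/-- Reduces register 9 modulo `n`. -/
def reduceMod : Program := .arith .div 10 9 0 ;; .arith .mul 10 10 0 ;; .arith .sub 9 9 10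

/-- Reduction modulo `n` keeps the sums within a machine word and loses nothing at the end, as a
single name is less than `n`. -/
def addLowEdge : Program :=
  .load 9 4 7 ;; .arith .add 9 9 5 ;; .store 4 7 9 ;;
  .load 9 4 8 ;; .arith .add 9 9 5 ;; .store 4 8 9 ;;
  .load 9 5 7 ;; .arith .add 9 9 8 ;; reduceMod ;; .store 5 7 9 ;;
  .load 9 5 8 ;; .arith .add 9 9 7 ;; reduceMod ;; .store 5 8 9

def classifyEdges : Program :=
  .const 6 0 ;; .loop (.lt 6 1)
    (loadEdge ;; .load 9 2 7 ;; .load 10 2 8 ;;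
      .cond (.lt 4 9) markEdge (.cond (.lt 4 10) markEdge addLowEdge) ;;
      .arith .add 6 6 5)

/-- Takes the vertex in register 7, and goes on to its only remaining neighbor, if there is one. -/
def takeVertex : Program :=
  .store 6 7 5 ;; .store 3 7 5 ;;
  .cond (.eq 9 5)
    (.load 8 5 7 ;;
      .load 9 4 8 ;; .arith .sub 9 9 5 ;; .store 4 8 9 ;;
      .load 9 5 8 ;; .arith .add 9 9 0 ;; .arith .sub 9 9 7 ;; reduceMod ;; .store 5 8 9 ;;
      .arith .add 7 8 12 ;; .const 11 1)
    skip

/-- Register 11 tells whether the chain goes on: it is cleared here, and set again only if a vertex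
is taken that has a remaining neighbor. -/
def tryVertex : Program :=
  .const 11 0 ;; .load 9 6 7 ;;
  .cond (.eq 9 12)
    (.load 9 4 7 ;; .const 10 2 ;;
      .cond (.lt 9 10) (.load 10 2 7 ;; .cond (.eq 10 4) takeVertex skip) skip)
    skip

/-- Taking a vertex can make at most one other vertex eligible, its last remaining neighbor. So no
queue is needed: from each start a single chain is followed, and the number of trials is at most `n`
plus the number of taken vertices. -/
def peel : Program :=
  .const 6 0 ;; .loop (.lt 6 0)
    (.arith .add 7 6 12 ;; .const 11 1 ;; .loop (.eq 11 5) tryVertex ;; .arith .add 6 6 5)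

/-- The test `t + t = 2 + c` expresses `2 * (t - 1) = c` without truncated subtraction. In the other
case all low edges can be colored greedily and nothing is taken. -/
def peelIfEven : Program :=
  .arith .add 9 4 4 ;; .const 10 2 ;; .arith .add 10 10 2 ;; .cond (.eq 9 10) peel skip

def rankVertices : Program :=
  .const 6 0 ;; .const 13 0 ;; .loop (.lt 6 0)
    (.load 9 3 6 ;; .cond (.eq 9 5) (.store 7 6 13 ;; .arith .add 13 13 5) skip ;;
      .arith .add 6 6 5)

/-- The output overwrites the input. This is safe because never more edges have been written than
read. -/
def writeEdges : Program :=
  .const 6 0 ;; .const 14 0 ;; .loop (.lt 6 1)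
    (loadEdge ;; .load 9 3 7 ;; .load 10 3 8 ;;
      .cond (.eq 9 5)
        (.cond (.eq 10 5)
          (.load 7 7 7 ;; .load 8 7 8 ;; .store 0 14 7 ;; .store 1 14 8 ;; .arith .add 14 14 5)
          skip)
        skip ;;
      .arith .add 6 6 5)

/-- Adding register 12, which is zero, copies a register. The budget is capped by the new number of
edges. -/
def writeHeader : Program :=
  .arith .add 0 13 12 ;; .arith .add 1 14 12 ;; .cond (.lt 14 3) (.arith .add 3 14 12) skip

/-- The kernelization, started with the degree bound in register 4 and with 1 in register 5. -/
def main : Program :=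
  countDegrees ;; classifyEdges ;; peelIfEven ;; rankVertices ;; writeEdges ;; writeHeader

end Kernel

/-! ### Edge lists -/

section EdgeList

variable {n : ℕ} {G : SimpleGraph (Fin n)} {l : List (Fin n × Fin n)}

/-- The neighbors of `v` through the edges in a list. -/
def listNbhd (l : List (Fin n × Fin n)) (v : Fin n) : Finset (Fin n) :=
  Finset.univ.filter fun w => (v, w) ∈ l ∨ (w, v) ∈ l

theorem listNbhd_append_self_left {a b : Fin n} :
    listNbhd (l ++ [(a, b)]) a = insert b (listNbhd l a) := by
  ext w
  simp only [listNbhd, Finset.mem_filter, Finset.mem_univ, List.mem_append, List.mem_singleton,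
    Prod.mk.injEq, true_and, Finset.mem_insert]
  constructor
  · rintro ((h | h) | (h | h))
    · exact Or.inr (Or.inl h)
    · exact Or.inl h
    · exact Or.inr (Or.inr h)
    · exact Or.inl (h.1.trans h.2)
  · rintro (h | h | h) <;> tauto

theorem listNbhd_append_self_right {a b : Fin n} :
    listNbhd (l ++ [(a, b)]) b = insert a (listNbhd l b) := by
  ext w
  simp only [listNbhd, Finset.mem_filter, Finset.mem_univ, List.mem_append, List.mem_singleton,
    Prod.mk.injEq, true_and, Finset.mem_insert, and_true]
  constructor
  · rintro ((h | h) | (h | h))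
    · exact Or.inr (Or.inl h)
    · exact Or.inl (h.2.trans h.1)
    · exact Or.inr (Or.inr h)
    · exact Or.inl h
  · rintro (h | h | h) <;> tauto

theorem listNbhd_append_of_ne {a b v : Fin n} (ha : v ≠ a) (hb : v ≠ b) :
    listNbhd (l ++ [(a, b)]) v = listNbhd l v := by
  ext w
  simp [listNbhd, ha, hb]

theorem IsEdgeList.adj (hl : IsEdgeList G l) {e : Fin n × Fin n} (he : e ∈ l) : G.Adj e.1 e.2 :=
  (hl.2 s(e.1, e.2)).1 (List.mem_map.2 ⟨e, he, rfl⟩)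

theorem IsEdgeList.mem_or_mem (hl : IsEdgeList G l) {v w : Fin n} :
    ((v, w) ∈ l ∨ (w, v) ∈ l) ↔ G.Adj v w := by
  rw [← SimpleGraph.mem_edgeSet, ← hl.2, List.mem_map]
  constructor
  · rintro (h | h)
    · exact ⟨_, h, rfl⟩
    · exact ⟨_, h, Sym2.eq_swap⟩
  · rintro ⟨⟨a, b⟩, he, h⟩
    rcases Sym2.eq_iff.1 h with ⟨rfl, rfl⟩ | ⟨rfl, rfl⟩
    · exact Or.inl he
    · exact Or.inr he

theorem IsEdgeList.listNbhd_eq (hl : IsEdgeList G l) (v : Fin n) : listNbhd l v = nbhd G v := by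
  ext w
  simp [listNbhd, hl.mem_or_mem]

/-- Neither orientation of an edge occurs before it, so reading the edge raises the count at both
endpoints by exactly one. -/
theorem IsEdgeList.notMem_take (hl : IsEdgeList G l) {i : ℕ} (hi : i < l.length) :
    (l[i].1, l[i].2) ∉ l.take i ∧ (l[i].2, l[i].1) ∉ l.take i := by
  have hnd : ((l.take (i + 1)).map fun e => s(e.1, e.2)).Nodup :=
    hl.1.sublist ((List.take_sublist _ _).map _)
  rw [List.take_succ_eq_append_getElem hi, List.map_append, List.nodup_append] at hnd
  have h := hnd.2.2
  constructor
  · intro hm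
    exact h _ (List.mem_map.2 ⟨_, hm, rfl⟩) _ (List.mem_map.2 ⟨_, List.mem_singleton.2 rfl, rfl⟩) rfl
  · intro hm
    exact h _ (List.mem_map.2 ⟨_, hm, rfl⟩) _ (List.mem_map.2 ⟨_, List.mem_singleton.2 rfl, rfl⟩)
      Sym2.eq_swap

theorem IsEdgeList.length_eq (hl : IsEdgeList G l) : l.length = G.edgeSet.ncard := by
  classical
  have : G.edgeSet = ((l.map fun e => s(e.1, e.2)).toFinset : Set (Sym2 (Fin n))) := by
    ext e
    simp only [List.coe_toFinset, Set.mem_ofPred_eq]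
    exact (hl.2 e).symm
  rw [this, Set.ncard_coe_finset, List.toFinset_card_of_nodup hl.1, List.length_map]

/-- The edges of the low graph in an edge list. -/
noncomputable def lowList (G : SimpleGraph (Fin n)) (t : ℕ) (l : List (Fin n × Fin n)) :
    List (Fin n × Fin n) :=
  l.filter fun e => decide ((nbhd G e.1).card ≤ t ∧ (nbhd G e.2).card ≤ t)

theorem mem_lowList {t : ℕ} {e : Fin n × Fin n} : e ∈ lowList G t l ↔
    e ∈ l ∧ (nbhd G e.1).card ≤ t ∧ (nbhd G e.2).card ≤ t := by
  simp [lowList]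

theorem IsEdgeList.listNbhd_lowList (hl : IsEdgeList G l) {t : ℕ} (v : Fin n) :
    listNbhd (lowList G t l) v = nbhd (lowGraph G t) v := by
  ext w
  simp only [listNbhd, mem_lowList, Finset.mem_filter, Finset.mem_univ, true_and, mem_nbhd,
    lowGraph_adj, ← hl.mem_or_mem]
  tauto

end EdgeList

/-! ### The phases of the program -/

/-- The part of the memory that does not change before the output is written. -/
structure Base {n : ℕ} (l : List (Fin n × Fin n)) (c k t : ℕ) (σ : Memory) : Prop where
  n : σ.reg 0 = n
  m : σ.reg 1 = l.length
  c : σ.reg 2 = c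
  k : σ.reg 3 = k
  t : σ.reg 4 = t
  one : σ.reg 5 = 1
  zero : σ.reg 12 = 0
  fst : ∀ (i : ℕ) (hi : i < l.length), σ.arr 0 i = l[i].1
  snd : ∀ (i : ℕ) (hi : i < l.length), σ.arr 1 i = l[i].2

section Phases

variable {n : ℕ} {l : List (Fin n × Fin n)} {c k t : ℕ} {σ : Memory}

theorem base_setReg {x v : ℕ} (hx : 6 ≤ x) (hx' : x ≠ 12) :
    Base l c k t (σ.setReg x v) ↔ Base l c k t σ := by
  have e : ∀ y, y < 6 ∨ y = 12 → (σ.setReg x v).reg y = σ.reg y := by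
    intro y hy
    simp only [reg_setReg]
    rw [if_neg (by omega)]
  constructor
  · rintro ⟨h0, h1, h2, h3, h4, h5, h6, h7, h8⟩
    rw [e _ (by simp)] at h0 h1 h2 h3 h4 h5 h6
    exact ⟨h0, h1, h2, h3, h4, h5, h6, h7, h8⟩
  · rintro ⟨h0, h1, h2, h3, h4, h5, h6, h7, h8⟩
    exact ⟨(e _ (by simp)).trans h0, (e _ (by simp)).trans h1, (e _ (by simp)).trans h2,
      (e _ (by simp)).trans h3, (e _ (by simp)).trans h4, (e _ (by simp)).trans h5,
      (e _ (by simp)).trans h6, h7, h8⟩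

theorem base_setArr {a i v : ℕ} (ha : 2 ≤ a) :
    Base l c k t (σ.setArr a i v) ↔ Base l c k t σ := by
  have e : ∀ b j, b < 2 → (σ.setArr a i v).arr b j = σ.arr b j := by
    intro b j hb
    simp only [arr_setArr]
    rw [if_neg (by omega)]
  constructor
  · rintro ⟨h0, h1, h2, h3, h4, h5, h6, h7, h8⟩
    exact ⟨h0, h1, h2, h3, h4, h5, h6, fun j hj => by rw [← h7 j hj, e _ _ (by omega)],
      fun j hj => by rw [← h8 j hj, e _ _ (by omega)]⟩
  · rintro ⟨h0, h1, h2, h3, h4, h5, h6, h7, h8⟩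
    exact ⟨h0, h1, h2, h3, h4, h5, h6, fun j hj => by rw [← h7 j hj, e _ _ (by omega)],
      fun j hj => by rw [← h8 j hj, e _ _ (by omega)]⟩

variable {W s : ℕ} {Q : ℕ → Memory → Prop} {G : SimpleGraph (Fin n)}

theorem wp_countDegrees (hl : IsEdgeList G l) (hW : 10 * (n + l.length + 1) ≤ W)
    (hB : Base l c k t σ) (h0 : ∀ a i, 2 ≤ a → σ.arr a i = 0)
    (hQ : ∀ s' τ, s' ≤ s + 20 * l.length + 20 → Base l c k t τ →
      (∀ v : Fin n, τ.arr 2 v = (nbhd G v).card) → (∀ a i, 3 ≤ a → τ.arr a i = 0) → Q s' τ) :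
    wp W Kernel.countDegrees Q s σ := by
  rw [Kernel.countDegrees, wp_seq, wp_const]
  refine ⟨by omega, ?_⟩
  refine wp_loop_count (N := l.length) (fun i s' τ => s' ≤ s + 20 * i + 10 ∧ Base l c k t τ ∧
    τ.reg 6 = i ∧ i ≤ l.length ∧ (∀ v : Fin n, τ.arr 2 v = (listNbhd (l.take i) v).card) ∧
    ∀ a i, 3 ≤ a → τ.arr a i = 0) ?_ ?_ ?_ ?_
  · rintro i s' τ ⟨-, hB, h6, hi, -, -⟩
    exact ⟨h6, hB.m, hi⟩
  · rintro i s' τ hi ⟨hs, hB, h6, -, hdeg, h3⟩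
    have htake := List.take_succ_eq_append_getElem hi
    obtain ⟨hn1, hn2⟩ := hl.notMem_take hi
    have hadj := hl.adj (List.getElem_mem hi)
    set a := l[i].1 with ha
    set b := l[i].2 with hb
    have hab : l[i] = (a, b) := rfl
    have hfb : b ∉ listNbhd (l.take i) a := by simp [listNbhd, hn1, hn2]
    have hfa : a ∉ listNbhd (l.take i) b := by simp [listNbhd, hn1, hn2]
    have hle : ∀ v, (listNbhd (l.take i) v).card ≤ n := fun v => by
      simpa using Finset.card_le_univ (listNbhd (l.take i) v)
    have hle1 := hle a
    have hle2 := hle b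
    have hne : (b : ℕ) ≠ a := fun h => hadj.ne (Fin.ext h.symm)
    simp [Kernel.loadEdge, wp_seq, wp_load, wp_arith, wp_store, ArithOp.eval, h6, hB.fst i hi,
      hB.snd i hi, hB.one, base_setReg, base_setArr, hB, hdeg, ← ha, ← hb, hne]
    refine ⟨by omega, by omega, by omega, by omega, by omega, fun v => ?_, ?_⟩
    · rw [htake, hab]
      rcases eq_or_ne v b with rfl | hvb
      · rw [listNbhd_append_self_right, Finset.card_insert_of_notMem hfa]
        simp
      rcases eq_or_ne v a with rfl | hva
      · rw [listNbhd_append_self_left, Finset.card_insert_of_notMem hfb]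
        simp [hne.symm]
      · rw [listNbhd_append_of_ne hva hvb]
        simp [hvb, hva, Fin.val_inj]
    · intro a' i' ha'
      simp [show a' ≠ 2 by omega, h3 a' i' ha']
  · rintro s' τ ⟨hs, hB, h6, -, hdeg, h3⟩
    refine hQ _ _ (by omega) hB (fun v => ?_) h3
    rw [hdeg, List.take_length, hl.listNbhd_eq]
  · refine ⟨by omega, (base_setReg (by omega) (by omega)).2 hB, by simp, by omega, fun v => ?_,
      fun a i ha => h0 a i (by omega)⟩
    simp [h0, listNbhd]

end Phases

/-! ### Classification of the edges into low edges and edges at high vertices -/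

section Phases

variable {n : ℕ} {l : List (Fin n × Fin n)} {c k t : ℕ} {σ : Memory}
variable {W s : ℕ} {Q : ℕ → Memory → Prop} {G : SimpleGraph (Fin n)}

theorem sub_div_mul_eq_mod (x n : ℕ) : x - x / n * n = x % n := Nat.mod_eq_sub_div_mul.symm

theorem wp_reduceMod (hW : σ.reg 9 ≤ W) : wp W Kernel.reduceMod Q s σ ↔
    Q (s + 3) (((σ.setReg 10 (σ.reg 9 / σ.reg 0)).setReg 10
      (σ.reg 9 / σ.reg 0 * σ.reg 0)).setReg 9 (σ.reg 9 % σ.reg 0)) := by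
  have h1 : σ.reg 9 / σ.reg 0 ≤ W := (Nat.div_le_self _ _).trans hW
  have h2 : σ.reg 9 / σ.reg 0 * σ.reg 0 ≤ W := (Nat.div_mul_le_self _ _).trans hW
  have h3 : σ.reg 9 % σ.reg 0 ≤ W := (Nat.mod_le _ _).trans hW
  simp [Kernel.reduceMod, wp_seq, wp_arith, ArithOp.eval, sub_div_mul_eq_mod, h1, h2, h3]

theorem lowList_take_succ {i : ℕ} (hi : i < l.length) : lowList G t (l.take (i + 1)) =
    if (nbhd G l[i].1).card ≤ t ∧ (nbhd G l[i].2).card ≤ t then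
      lowList G t (l.take i) ++ [l[i]] else lowList G t (l.take i) := by
  rw [List.take_succ_eq_append_getElem hi, lowList, List.filter_append]
  split_ifs with h
  · simp [h, lowList]
  · simp [h, lowList]

/-- `v` is a vertex of degree more than `t`, or a neighbor of such a vertex. -/
def IsNearHigh (G : SimpleGraph (Fin n)) (t : ℕ) (l : List (Fin n × Fin n)) (v : Fin n) : Prop :=
  ∃ e ∈ l, (v = e.1 ∨ v = e.2) ∧ (t < (nbhd G e.1).card ∨ t < (nbhd G e.2).card)

theorem isNearHigh_append {e : Fin n × Fin n} {v : Fin n} : IsNearHigh G t (l ++ [e]) v ↔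
    IsNearHigh G t l v ∨
      (v = e.1 ∨ v = e.2) ∧ (t < (nbhd G e.1).card ∨ t < (nbhd G e.2).card) := by
  simp [IsNearHigh, or_and_right, exists_or]

theorem IsEdgeList.isNearHigh_iff (hl : IsEdgeList G l) {v : Fin n} : IsNearHigh G t l v ↔
    ∃ w, G.Adj v w ∧ (t < (nbhd G v).card ∨ t < (nbhd G w).card) := by
  constructor
  · rintro ⟨⟨a, b⟩, he, rfl | rfl, h⟩
    · exact ⟨_, hl.adj he, h⟩
    · exact ⟨_, (hl.adj he).symm, h.symm⟩
  · rintro ⟨w, hvw, h⟩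
    rcases hl.mem_or_mem.2 hvw with he | he
    · exact ⟨_, he, Or.inl rfl, h⟩
    · exact ⟨_, he, Or.inr rfl, h.symm⟩

/-- The contents of the arrays after the first edges have been classified. -/
structure Classified (G : SimpleGraph (Fin n)) (t : ℕ) (l : List (Fin n × Fin n)) (σ : Memory) :
    Prop where
  deg : ∀ v : Fin n, σ.arr 2 v = (nbhd G v).card
  keep : ∀ v : Fin n, σ.arr 3 v = 1 ↔ IsNearHigh G t l v
  lowDeg : ∀ v : Fin n, σ.arr 4 v = (listNbhd (lowList G t l) v).card
  lowSum : ∀ v : Fin n, σ.arr 5 v = (∑ w ∈ listNbhd (lowList G t l) v, (w : ℕ)) % n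
  taken : ∀ v : Fin n, σ.arr 6 v = 0

theorem wp_classifyEdges (hl : IsEdgeList G l) (hW : 10 * (n + l.length + 1) ≤ W)
    (hB : Base l c k t σ) (hdeg : ∀ v : Fin n, σ.arr 2 v = (nbhd G v).card)
    (h0 : ∀ a i, 3 ≤ a → σ.arr a i = 0)
    (hQ : ∀ s' τ, s' ≤ s + 50 * l.length + 20 → Base l c k t τ → Classified G t l τ → Q s' τ) :
    wp W Kernel.classifyEdges Q s σ := by
  rw [Kernel.classifyEdges, wp_seq, wp_const]
  refine ⟨by omega, ?_⟩
  refine wp_loop_count (N := l.length) (fun i s' τ => s' ≤ s + 50 * i + 10 ∧ Base l c k t τ ∧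
    τ.reg 6 = i ∧ i ≤ l.length ∧ Classified G t (l.take i) τ) ?_ ?_ ?_ ?_
  · rintro i s' τ ⟨-, hB, h6, hi, -⟩
    exact ⟨h6, hB.m, hi⟩
  · rintro i s' τ hi ⟨hs, hB, h6, -, hC⟩
    have htake := List.take_succ_eq_append_getElem hi
    have hlow := lowList_take_succ (G := G) (t := t) hi
    obtain ⟨hn1, hn2⟩ := hl.notMem_take hi
    have hadj := hl.adj (List.getElem_mem hi)
    have hfst := hB.fst i hi
    have hsnd := hB.snd i hi
    have hnear := fun v => isNearHigh_append (G := G) (t := t) (l := l.take i) (e := l[i]) (v := v)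
    rw [← htake] at hnear
    generalize hea : l[i].1 = a at *
    generalize heb : l[i].2 = b at *
    have hab : l[i] = (a, b) := by rw [← hea, ← heb]
    rw [hab] at hlow
    have hne : (b : ℕ) ≠ a := fun h => hadj.ne (Fin.ext h.symm)
    simp [Kernel.loadEdge, wp_seq, wp_load, h6, hfst, hsnd, hC.deg]
    set ρ := (((τ.setReg 7 a).setReg 8 b).setReg 9 (nbhd G a).card).setReg 10 (nbhd G b).card
      with hρ
    have hBρ : Base l c k t ρ := by simp [hρ, base_setReg, hB]
    have r6 : ρ.reg 6 = i := by simp [hρ, h6]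
    have r7 : ρ.reg 7 = a := by simp [hρ]
    have r8 : ρ.reg 8 = b := by simp [hρ]
    have r9 : ρ.reg 9 = (nbhd G a).card := by simp [hρ]
    have r10 : ρ.reg 10 = (nbhd G b).card := by simp [hρ]
    have hCρ : Classified G t (l.take i) ρ := ⟨hC.deg, hC.keep, hC.lowDeg, hC.lowSum, hC.taken⟩
    clear_value ρ
    refine wp_mono (Q := fun s'' τ' => s'' ≤ s' + 4 + 30 ∧ Base l c k t τ' ∧
          τ'.reg 6 = i ∧ Classified G t (l.take (i + 1)) τ') ?_ ?_
    · by_cases hH : t < (nbhd G a).card ∨ t < (nbhd G b).card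
      · have hlow' : lowList G t (l.take (i + 1)) = lowList G t (l.take i) := by
          rw [hlow, if_neg (by omega)]
        have hmark : ∀ s'' ≤ s' + 6, wp W Kernel.markEdge (fun s'' τ' => s'' ≤ s' + 4 + 30 ∧
            Base l c k t τ' ∧ τ'.reg 6 = i ∧ Classified G t (l.take (i + 1)) τ') s'' ρ := by
          intro s'' hs''
          simp [Kernel.markEdge, wp_seq, wp_store, base_setArr, hBρ, r6, hBρ.one, r7, r8]
          refine ⟨by omega, fun v => ?_, fun v => ?_, fun v => ?_, fun v => ?_, fun v => ?_⟩
          · simp [hCρ.deg]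
          · rw [hnear v]
            by_cases h1 : v = b
            · simp [h1, hH]
            by_cases h2 : v = a
            · simp [h2, hH]
            · simp [h1, h2, Fin.val_inj, hCρ.keep]
          · rw [hlow']
            simp [hCρ.lowDeg]
          · rw [hlow']
            simp [hCρ.lowSum]
          · simp [hCρ.taken]
        rw [wp_cond]
        refine ⟨fun _ => hmark _ (by omega), fun h1 => ?_⟩
        rw [wp_cond]
        refine ⟨fun _ => hmark _ (by omega), fun h2 => ?_⟩
        simp only [RegTest.Holds, r9, r10, hBρ.t] at h1 h2
        exact absurd hH (by tauto)
      · rw [wp_cond]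
        refine ⟨fun h1 => ?_, fun _ => ?_⟩
        · simp only [RegTest.Holds, r9, hBρ.t] at h1
          exact absurd (Or.inl h1) hH
        rw [wp_cond]
        refine ⟨fun h1 => ?_, fun _ => ?_⟩
        · simp only [RegTest.Holds, r10, hBρ.t] at h1
          exact absurd (Or.inr h1) hH
        rw [if_pos (by omega)] at hlow
        have hfb : b ∉ listNbhd (lowList G t (l.take i)) a := by
          simp [listNbhd, mem_lowList, hn1, hn2]
        have hfa : a ∉ listNbhd (lowList G t (l.take i)) b := by
          simp [listNbhd, mem_lowList, hn1, hn2]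
        have hle : ∀ v, (listNbhd (lowList G t (l.take i)) v).card ≤ n := fun v => by
          simpa using Finset.card_le_univ (listNbhd (lowList G t (l.take i)) v)
        have hle1 := hle a
        have hle2 := hle b
        have hmod : ∀ x, x % n < n := fun x => Nat.mod_lt _ a.pos
        have hm1 := hmod (∑ w ∈ listNbhd (lowList G t (l.take i)) a, (w : ℕ))
        have hm2 := hmod (∑ w ∈ listNbhd (lowList G t (l.take i)) b, (w : ℕ))
        have hca := Finset.card_insert_of_notMem hfb
        have hcb := Finset.card_insert_of_notMem hfa
        have hsa := Finset.sum_insert (f := fun w : Fin n => (w : ℕ)) hfb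
        have hsb := Finset.sum_insert (f := fun w : Fin n => (w : ℕ)) hfa
        rw [← listNbhd_append_self_left, ← hlow] at hca hsa
        rw [← listNbhd_append_self_right, ← hlow] at hcb hsb
        have ha := a.isLt
        have hb := b.isLt
        have hlow1 := hCρ.lowDeg
        have hlow2 := hCρ.lowSum
        have ho1 : (listNbhd (lowList G t (l.take i)) a).card + 1 ≤ W := by omega
        have ho2 : (listNbhd (lowList G t (l.take i)) b).card + 1 ≤ W := by omega
        have ho3 : (∑ w ∈ listNbhd (lowList G t (l.take i)) a, (w : ℕ)) % n + b ≤ W := by omega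
        have ho4 : (∑ w ∈ listNbhd (lowList G t (l.take i)) b, (w : ℕ)) % n + a ≤ W := by omega
        simp [Kernel.addLowEdge, wp_seq, wp_load, wp_arith, wp_store, wp_reduceMod, ArithOp.eval,
          r6, r7, r8, hBρ.one, hBρ.n, base_setReg, base_setArr, hBρ, hlow1, hlow2, hne, ho1, ho2,
          ho3, ho4]
        have hother : ∀ v, v ≠ a → v ≠ b → listNbhd (lowList G t (l.take (i + 1))) v =
            listNbhd (lowList G t (l.take i)) v := fun v h1 h2 => by
          rw [hlow, listNbhd_append_of_ne h1 h2]
        refine ⟨fun v => ?_, fun v => ?_, fun v => ?_, fun v => ?_, fun v => ?_⟩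
        · simp [hCρ.deg]
        · rw [hnear v]
          simp [hCρ.keep, hH]
        · rcases eq_or_ne v b with rfl | h1
          · simp [hcb]
          rcases eq_or_ne v a with rfl | h2
          · simp [hca, hne.symm]
          · simp [hother v h2 h1, hlow1, h1, h2, Fin.val_inj]
        · rcases eq_or_ne v b with rfl | h1
          · simp only [arr_setArr, arr_setReg, and_self, if_true]
            rw [hsb, add_comm]
          rcases eq_or_ne v a with rfl | h2
          · simp only [arr_setArr, arr_setReg, and_self, if_true, hne.symm, and_false, if_false]
            rw [hsa, add_comm]
          · simp [hother v h2 h1, hlow2, h1, h2, Fin.val_inj]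
        · simp [hCρ.taken]
    · rintro s'' τ' ⟨hs', hB', h6', hC'⟩
      rw [wp_arith]
      simp only [ArithOp.eval, h6', hB'.one]
      refine ⟨by omega, by omega, (base_setReg (by omega) (by omega)).2 hB', by simp, by omega, ?_⟩
      exact ⟨hC'.deg, hC'.keep, hC'.lowDeg, hC'.lowSum, hC'.taken⟩
  · rintro s' τ ⟨hs, hB, h6, -, hC⟩
    rw [List.take_length] at hC
    exact hQ _ _ (by omega) hB hC
  · refine ⟨by omega, (base_setReg (by omega) (by omega)).2 hB, by simp, by omega, ?_⟩
    refine ⟨fun v => ?_, fun v => ?_, fun v => ?_, fun v => ?_, fun v => ?_⟩ <;>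
      simp [h0, hdeg, listNbhd, lowList, IsNearHigh]

end Phases

/-! ### Peeling in linear time -/

section Phases

variable {n : ℕ} {l : List (Fin n × Fin n)} {c k t : ℕ} {σ : Memory}
variable {W s : ℕ} {Q : ℕ → Memory → Prop} {G : SimpleGraph (Fin n)}

/-- The contents of the arrays when the vertices in `D` have been taken. -/
structure PeelState (G : SimpleGraph (Fin n)) (t : ℕ) (P : Fin n → Prop) (D : Finset (Fin n))
    (σ : Memory) : Prop where
  deg : ∀ v : Fin n, σ.arr 2 v = (nbhd G v).card
  keep : ∀ v : Fin n, σ.arr 3 v = 1 ↔ v ∈ D ∨ P v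
  lowDeg : ∀ v : Fin n, v ∉ D → σ.arr 4 v = (nbhd (lowGraph G t) v \ D).card
  lowSum : ∀ v : Fin n, v ∉ D → σ.arr 5 v = (∑ w ∈ nbhd (lowGraph G t) v \ D, (w : ℕ)) % n
  taken : ∀ v : Fin n, σ.arr 6 v = if v ∈ D then 1 else 0
  peeled : IsPeeled (lowGraph G t) {v | (nbhd G v).card = t} D

theorem PeelState.congr {P : Fin n → Prop} {D : Finset (Fin n)} {τ : Memory}
    (h : PeelState G t P D σ) (hστ : τ.arr = σ.arr) : PeelState G t P D τ := by
  obtain ⟨h1, h2, h3, h4, h5, h6⟩ := h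
  rw [← hστ] at h1 h2 h3 h4 h5
  exact ⟨h1, h2, h3, h4, h5, h6⟩

/-- The vertex `v` cannot be taken after `D`. -/
def IsStuck (G : SimpleGraph (Fin n)) (t : ℕ) (D : Finset (Fin n)) (v : Fin n) : Prop :=
  v ∉ D → (nbhd G v).card = t → 2 ≤ (nbhd (lowGraph G t) v \ D).card

/-- Adding `n` first prevents truncation; then `u` cancels modulo `n`. -/
theorem add_mod_sub_mod {S u n : ℕ} (hu : u < n) : ((S + u) % n + n - u) % n = S % n := by
  have h : ((S + u) % n + n - u) + u ≡ S + u [MOD n] := by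
    rw [Nat.sub_add_cancel (by omega)]
    simp [Nat.ModEq]
  exact Nat.ModEq.add_right_cancel' u h

theorem sdiff_insert_of_notMem {α : Type*} [DecidableEq α] {A D : Finset α} {u : α}
    (h : u ∉ A) : A \ insert u D = A \ D := by
  ext x
  simp only [Finset.mem_sdiff, Finset.mem_insert, not_or]
  refine and_congr_right fun hx => ?_
  have : x ≠ u := fun h' => h (h' ▸ hx)
  tauto

theorem sdiff_insert_eq_erase {α : Type*} [DecidableEq α] {A D : Finset α} {u : α} :
    A \ insert u D = (A \ D).erase u := by
  ext x
  simp only [Finset.mem_sdiff, Finset.mem_insert, Finset.mem_erase]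
  tauto

/-- What happens to the state in one step of the peeling. -/
def PeelStep (G : SimpleGraph (Fin n)) (t : ℕ) (P : Fin n → Prop) (D : Finset (Fin n)) (u : Fin n)
    (τ : Memory) : Prop :=
  ∃ (D' : Finset (Fin n)) (u' : Fin n), PeelState G t P D' τ ∧ τ.reg 7 = u' ∧ τ.reg 11 ≤ 1 ∧
    ((D' = D ∧ τ.reg 11 = 0) ∨ D'.card = D.card + 1) ∧
    ∀ v, (IsStuck G t D v ∨ v = u) → IsStuck G t D' v ∨ (v = u' ∧ τ.reg 11 = 1)

/-- Among the untaken vertices, only the last remaining neighbor of `u` loses a remaining neighbor,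
so only this vertex can cease to be stuck. The entries of taken vertices are left stale. -/
theorem wp_takeVertex {P : Fin n → Prop} {D : Finset (Fin n)} {u : Fin n} {i : ℕ}
    (hW : 10 * (n + l.length + 1) ≤ W) (hB : Base l c k t σ) (hS : PeelState G t P D σ)
    (h6 : σ.reg 6 = i) (h7 : σ.reg 7 = u) (h9 : σ.reg 9 = (nbhd (lowGraph G t) u \ D).card)
    (h11 : σ.reg 11 = 0) (hu : u ∉ D) (hut : (nbhd G u).card = t)
    (hle : (nbhd (lowGraph G t) u \ D).card < 2)
    (hQ : ∀ s' τ, s' ≤ s + 20 → Base l c k t τ → τ.reg 6 = i → PeelStep G t P D u τ → Q s' τ) :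
    wp W Kernel.takeVertex Q s σ := by
  have hpeel : IsPeeled (lowGraph G t) {v | (nbhd G v).card = t} (insert u D) :=
    hS.peeled.step hu hut (by omega)
  have hcard := Finset.card_insert_of_notMem hu
  have hnb : ∀ v, v ∉ D → v ∉ nbhd (lowGraph G t) u \ D → u ∉ nbhd (lowGraph G t) v := by
    intro v hv h hv'
    exact h (Finset.mem_sdiff.2 ⟨mem_nbhd.2 (mem_nbhd.1 hv').symm, hv⟩)
  have hstuck : IsStuck G t (insert u D) u := fun h => absurd (Finset.mem_insert_self _ _) h
  have hstuck' : ∀ v, v ∉ nbhd (lowGraph G t) u \ D → IsStuck G t D v →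
      IsStuck G t (insert u D) v := by
    intro v hv h hvD
    rw [Finset.mem_insert, not_or] at hvD
    rw [sdiff_insert_of_notMem (hnb v hvD.2 hv)]
    exact h hvD.2
  rw [Kernel.takeVertex, wp_seq, wp_store, wp_seq, wp_store, wp_cond]
  simp only [RegTest.Holds, reg_setArr, h7, hB.one, h9]
  refine ⟨fun h1 => ?_, fun h1 => ?_⟩
  · obtain ⟨w, hw⟩ := Finset.card_eq_one.1 h1
    have hwmem : w ∈ nbhd (lowGraph G t) u \ D := by rw [hw]; simp
    have hwD : w ∉ D := (Finset.mem_sdiff.1 hwmem).2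
    have hadj : (lowGraph G t).Adj u w := mem_nbhd.1 (Finset.mem_sdiff.1 hwmem).1
    have hwu : (w : ℕ) ≠ u := fun h => hadj.ne (Fin.ext h.symm)
    have huw : u ∈ nbhd (lowGraph G t) w \ D :=
      Finset.mem_sdiff.2 ⟨mem_nbhd.2 hadj.symm, hu⟩
    -- A sum with a single term below `n` is its own residue, so it names the neighbor.
    have h5u : σ.arr 5 u = w := by
      rw [hS.lowSum u hu, hw, Finset.sum_singleton, Nat.mod_eq_of_lt w.isLt]
    have h4w := hS.lowDeg w hwD
    have h5w := hS.lowSum w hwD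
    have hc := Finset.card_erase_add_one huw
    have hs := Finset.sum_erase_add (nbhd (lowGraph G t) w \ D) (fun x : Fin n => (x : ℕ)) huw
    rw [← sdiff_insert_eq_erase] at hc hs
    have hle' : (nbhd (lowGraph G t) w \ D).card ≤ n := by
      simpa using Finset.card_le_univ (nbhd (lowGraph G t) w \ D)
    rw [← hs] at h5w
    have hmod := Nat.mod_lt (∑ x ∈ nbhd (lowGraph G t) w \ insert u D, (x : ℕ) + u) w.pos
    have hu' := u.isLt
    have hw' := w.isLt
    have o1 : (nbhd (lowGraph G t) w \ D).card ≤ W + 1 := by omega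
    have o2 : (∑ x ∈ nbhd (lowGraph G t) w \ insert u D, (x : ℕ) + u) % n + n ≤ W := by omega
    have o3 : (∑ x ∈ nbhd (lowGraph G t) w \ insert u D, (x : ℕ) + u) % n + n ≤ W + u := by omega
    have o4 : (w : ℕ) ≤ W := by omega
    have o5 : 1 ≤ W := by omega
    have key := add_mod_sub_mod (S := ∑ x ∈ nbhd (lowGraph G t) w \ insert u D, (x : ℕ)) hu'
    simp [wp_seq, wp_load, wp_arith, wp_store, wp_const, wp_reduceMod, ArithOp.eval, h7, hB.one,
      hB.n, hB.zero, h5u, h4w, h5w, o1, o2, o3, o4, o5, key]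
    refine hQ _ _ (by omega) (by simp [base_setReg, base_setArr, hB]) (by simp [h6])
      ⟨insert u D, w, ⟨fun v => ?_, fun v => ?_, fun v hv => ?_, fun v hv => ?_, fun v => ?_, hpeel⟩,
        by simp, by simp, Or.inr hcard, fun v hv => ?_⟩
    · simp [hS.deg]
    · by_cases hvu : v = u
      · simp [hvu]
      · simp [hvu, Fin.val_inj, hS.keep]
    · rw [Finset.mem_insert, not_or] at hv
      rcases eq_or_ne v w with rfl | hvw
      · simp
        omega
      · rw [sdiff_insert_of_notMem (hnb v hv.2 (by rw [hw]; simpa using hvw))]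
        simp [hvw, Fin.val_inj, hS.lowDeg v hv.2]
    · rw [Finset.mem_insert, not_or] at hv
      rcases eq_or_ne v w with rfl | hvw
      · simp
      · rw [sdiff_insert_of_notMem (hnb v hv.2 (by rw [hw]; simpa using hvw))]
        simp [hvw, Fin.val_inj, hS.lowSum v hv.2]
    · by_cases hvu : v = u
      · simp [hvu]
      · simp [hvu, Fin.val_inj, hS.taken]
    · by_cases hvw : v = w
      · exact Or.inr ⟨hvw, by simp⟩
      · refine Or.inl ?_
        rcases hv with hv | rfl
        · exact hstuck' v (by rw [hw]; simpa using hvw) hv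
        · exact hstuck
  · have hempty : nbhd (lowGraph G t) u \ D = ∅ := Finset.card_eq_zero.1 (by omega)
    simp only [Kernel.skip, wp_const]
    refine ⟨by omega, hQ _ _ (by omega) (by simp [base_setReg, base_setArr, hB]) (by simp [h6])
      ⟨insert u D, u, ⟨fun v => ?_, fun v => ?_, fun v hv => ?_, fun v hv => ?_, fun v => ?_, hpeel⟩,
        by simp [h7], by simp [h11], Or.inr hcard, fun v hv => ?_⟩⟩
    · simp [hS.deg]
    · by_cases hvu : v = u
      · simp [hvu]
      · simp [hvu, Fin.val_inj, hS.keep]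
    · rw [Finset.mem_insert, not_or] at hv
      rw [sdiff_insert_of_notMem (hnb v hv.2 (by simp [hempty]))]
      simp [hS.lowDeg v hv.2]
    · rw [Finset.mem_insert, not_or] at hv
      rw [sdiff_insert_of_notMem (hnb v hv.2 (by simp [hempty]))]
      simp [hS.lowSum v hv.2]
    · by_cases hvu : v = u
      · simp [hvu]
      · simp [hvu, Fin.val_inj, hS.taken]
    · refine Or.inl ?_
      rcases hv with hv | rfl
      · exact hstuck' v (by simp [hempty]) hv
      · exact hstuck

theorem wp_tryVertex {P : Fin n → Prop} {D : Finset (Fin n)} {u : Fin n} {i : ℕ}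
    (hW : 10 * (n + l.length + 1) ≤ W) (hB : Base l c k t σ) (hS : PeelState G t P D σ)
    (h6 : σ.reg 6 = i) (h7 : σ.reg 7 = u)
    (hQ : ∀ s' τ, s' ≤ s + 30 → Base l c k t τ → τ.reg 6 = i → PeelStep G t P D u τ → Q s' τ) :
    wp W Kernel.tryVertex Q s σ := by
  have hfail : ∀ s' τ, s' ≤ s + 30 → τ.arr = σ.arr → Base l c k t τ → τ.reg 6 = i →
      τ.reg 7 = u → τ.reg 11 = 0 → IsStuck G t D u → Q s' τ := by
    intro s' τ hs ha hB' r6 r7 r11 hu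
    refine hQ s' τ hs hB' r6 ⟨D, u, hS.congr ha, r7, by omega, Or.inl ⟨rfl, r11⟩, fun v hv => ?_⟩
    rcases hv with hv | rfl
    · exact Or.inl hv
    · exact Or.inl hu
  have o1 : 0 ≤ W := by omega
  have o2 : 2 ≤ W := by omega
  by_cases hu : u ∈ D
  · have ht : σ.arr 6 u = 1 := by rw [hS.taken, if_pos hu]
    simp [Kernel.tryVertex, Kernel.skip, wp_seq, wp_const, wp_load, wp_cond, RegTest.Holds, h7, ht,
      hB.zero]
    exact hfail _ _ (by omega) (by simp) (by simp [base_setReg, hB]) (by simp [h6]) (by simp [h7])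
      (by simp) (fun h => absurd hu h)
  have ht : σ.arr 6 u = 0 := by rw [hS.taken, if_neg hu]
  have hd := hS.lowDeg u hu
  by_cases h2 : (nbhd (lowGraph G t) u \ D).card < 2
  · by_cases hut : (nbhd G u).card = t
    · have hd2 : σ.arr 2 u = t := by rw [hS.deg, hut]
      simp [Kernel.tryVertex, Kernel.skip, wp_seq, wp_const, wp_load, wp_cond, RegTest.Holds, h7, ht,
        hB.zero, hd, h2, o2, hd2, hB.t]
      refine wp_takeVertex (u := u) (D := D) (P := P) (i := i) hW (by simp [base_setReg, hB])
        (hS.congr (by simp)) (by simp [h6])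
        (by simp [h7]) (by simp) (by simp) hu hut h2 fun s' τ hs => hQ s' τ (by omega)
    · have hd2 : σ.arr 2 u ≠ t := by rw [hS.deg]; exact hut
      simp [Kernel.tryVertex, Kernel.skip, wp_seq, wp_const, wp_load, wp_cond, RegTest.Holds, h7, ht,
        hB.zero, hd, h2, o2, hd2, hB.t]
      exact hfail _ _ (by omega) (by simp) (by simp [base_setReg, hB]) (by simp [h6]) (by simp [h7])
        (by simp) (fun _ h => absurd h hut)
  · simp [Kernel.tryVertex, Kernel.skip, wp_seq, wp_const, wp_load, wp_cond, RegTest.Holds, h7, ht,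
      hB.zero, hd, h2, o2]
    exact hfail _ _ (by omega) (by simp) (by simp [base_setReg, hB]) (by simp [h6]) (by simp [h7])
      (by simp) (fun _ _ => not_lt.1 h2)

/-- The time is amortized: each taken vertex pays 60 steps for the trial that takes it, and each
start pays 70 steps for the failing trial and for the overhead of its round. -/
theorem wp_peel {P : Fin n → Prop} (hW : 10 * (n + l.length + 1) ≤ W) (hB : Base l c k t σ)
    (hS : PeelState G t P ∅ σ)
    (hQ : ∀ s' τ D, s' ≤ s + 130 * n + 20 → Base l c k t τ → PeelState G t P D τ →
      (∀ v, IsStuck G t D v) → Q s' τ) : wp W Kernel.peel Q s σ := by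
  rw [Kernel.peel, wp_seq, wp_const]
  refine ⟨by omega, ?_⟩
  refine wp_loop_count (N := n) (fun i s' τ => i ≤ n ∧ Base l c k t τ ∧ τ.reg 6 = i ∧
    ∃ D, s' ≤ s + 70 * i + 60 * D.card + 10 ∧ PeelState G t P D τ ∧
      ∀ v : Fin n, (v : ℕ) < i → IsStuck G t D v) ?_ ?_ ?_ ?_
  · rintro i s' τ ⟨hi, hB, h6, -⟩
    exact ⟨h6, hB.n, hi⟩
  · rintro i s' τ hi ⟨-, hB, h6, D, hs, hS, hstuck⟩
    have o1 : 1 ≤ W := by omega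
    have o2 : i ≤ W := by omega
    simp only [wp_seq, wp_arith, wp_const, ArithOp.eval, h6, hB.zero, add_zero, o1, o2, true_and]
    -- A success enlarges `D` and lowers the measure by at least two even if the flag in register 11
    -- stays 1; a failure clears the flag and lowers it by one. The term `40 * τ.reg 11` reserves
    -- the time for the trial that is still due.
    refine wp_loop (j := 2 * n + 1 - 2 * D.card) (fun j s' τ => Base l c k t τ ∧ τ.reg 6 = i ∧
      ∃ (D : Finset (Fin n)) (u : Fin n), PeelState G t P D τ ∧ τ.reg 7 = u ∧ τ.reg 11 ≤ 1 ∧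
        s' ≤ s + 70 * i + 60 * D.card + 55 - 40 * τ.reg 11 ∧ j + 2 * D.card = 2 * n + τ.reg 11 ∧
        ∀ v : Fin n, (v : ℕ) < i + 1 → IsStuck G t D v ∨ (v = u ∧ τ.reg 11 = 1)) ?_ ?_ ?_
    · rintro j s' τ ⟨hB, h6, D, u, hS, h7, h11, hs, hj, hstuck⟩ hb
      simp only [RegTest.Holds, hB.one] at hb
      refine wp_tryVertex hW hB hS h6 h7 fun s'' τ' hs' hB' h6' hstep => ?_
      obtain ⟨D', u', hS', h7', h11', hD', hstuck'⟩ := hstep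
      have hcard : D'.card ≤ n := by simpa using Finset.card_le_univ D'
      refine ⟨2 * n + τ'.reg 11 - 2 * D'.card, ?_, hB', h6', D', u', hS', h7', h11', ?_, ?_, ?_⟩
      · rcases hD' with ⟨rfl, h⟩ | h <;> omega
      · rcases hD' with ⟨rfl, h⟩ | h <;> omega
      · omega
      · intro v hv
        refine hstuck' v ((hstuck v hv).imp_right And.left)
    · rintro j s' τ ⟨hB, h6, D, u, hS, h7, h11, hs, hj, hstuck⟩ hb
      simp only [RegTest.Holds, hB.one] at hb
      rw [wp_arith]
      simp only [ArithOp.eval, h6, hB.one]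
      refine ⟨by omega, by omega, (base_setReg (by omega) (by omega)).2 hB, by simp, D, by omega,
        hS.congr (by simp), fun v hv => ?_⟩
      rcases hstuck v hv with h | h
      · exact h
      · exact absurd h.2 hb
    · have hcard : D.card ≤ n := by simpa using Finset.card_le_univ D
      refine ⟨by simp [base_setReg, hB], by simp [h6], D, ⟨i, hi⟩, hS.congr (by simp), by simp,
        by simp, by simp; omega, by simp; omega, fun v hv => ?_⟩
      rcases Nat.lt_succ_iff_lt_or_eq.1 hv with h | h
      · exact Or.inl (hstuck v h)
      · exact Or.inr ⟨Fin.ext h, by simp⟩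
  · rintro s' τ ⟨-, hB, h6, D, hs, hS, hstuck⟩
    have hcard : D.card ≤ n := by simpa using Finset.card_le_univ D
    exact hQ _ _ D (by omega) hB hS fun v => hstuck v v.isLt
  · refine ⟨by omega, (base_setReg (by omega) (by omega)).2 hB, by simp, ∅, by simp,
      hS.congr (by simp), fun v hv => absurd hv (by omega)⟩

/-- The vertices that are kept. -/
structure Kept (G : SimpleGraph (Fin n)) (c t : ℕ) (P : Fin n → Prop) (D : Finset (Fin n))
    (σ : Memory) : Prop where
  keep : ∀ v : Fin n, σ.arr 3 v = 1 ↔ v ∈ D ∨ P v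
  peeled : IsPeeled (lowGraph G t) {v | (nbhd G v).card = t} D
  stuck : 2 * t = c + 2 → ∀ v, IsStuck G t D v
  empty : 2 * t ≠ c + 2 → D = ∅

theorem wp_peelIfEven (hl : IsEdgeList G l) (hW : 10 * (n + l.length + c + t + 1) ≤ W)
    (hB : Base l c k t σ) (hC : Classified G t l σ)
    (hQ : ∀ s' τ D, s' ≤ s + 130 * n + 40 → Base l c k t τ → Kept G c t (IsNearHigh G t l) D τ →
      Q s' τ) : wp W Kernel.peelIfEven Q s σ := by
  have hS : PeelState G t (IsNearHigh G t l) ∅ σ := by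
    refine ⟨hC.deg, fun v => ?_, fun v _ => ?_, fun v _ => ?_, fun v => ?_, .empty⟩
    · simp [hC.keep]
    · rw [hC.lowDeg, hl.listNbhd_lowList, Finset.sdiff_empty]
    · rw [hC.lowSum, hl.listNbhd_lowList, Finset.sdiff_empty]
    · simp [hC.taken]
  have o1 : t + t ≤ W := by omega
  have o2 : 2 ≤ W := by omega
  have o3 : 2 + c ≤ W := by omega
  simp only [Kernel.peelIfEven, wp_seq, wp_arith, wp_const, ArithOp.eval, hB.t, hB.c, reg_setReg,
    o1, o2, o3, true_and, wp_cond, RegTest.Holds, Nat.reduceEqDiff, if_true, if_false]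
  refine ⟨fun h => ?_, fun h => ?_⟩
  · refine wp_peel (P := IsNearHigh G t l) (by omega) (by simp [base_setReg, hB])
      (hS.congr (by simp)) fun s' τ D hs hB' hS' hst => hQ s' τ D (by omega) hB'
        ⟨hS'.keep, hS'.peeled, fun _ => hst, fun h' => ?_⟩
    exact absurd (by omega) h'
  · simp only [Kernel.skip, wp_const]
    refine ⟨by omega, hQ _ _ ∅ (by omega) (by simp [base_setReg, hB])
      ⟨fun v => by simp [hC.keep], .empty, fun h' => ?_, fun _ => rfl⟩⟩
    omega

end Phases

/-! ### Renaming the kept vertices and writing the output -/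

section Phases

variable {n : ℕ} {l : List (Fin n × Fin n)} {c k t : ℕ} {σ : Memory}
variable {W s : ℕ} {Q : ℕ → Memory → Prop} {G : SimpleGraph (Fin n)}

/-- The number of elements of `K` that are smaller than `i`. -/
def rankIn (K : Finset (Fin n)) (i : ℕ) : ℕ := (K.filter fun v : Fin n => (v : ℕ) < i).card

theorem rankIn_succ {K : Finset (Fin n)} {i : ℕ} (hi : i < n) :
    rankIn K (i + 1) = rankIn K i + if (⟨i, hi⟩ : Fin n) ∈ K then 1 else 0 := by
  split_ifs with h
  · have hnot : (⟨i, hi⟩ : Fin n) ∉ K.filter fun v : Fin n => (v : ℕ) < i := by simp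
    rw [rankIn, rankIn, ← Finset.card_insert_of_notMem hnot]
    congr 1
    ext v
    simp only [Finset.mem_filter, Finset.mem_insert, Fin.ext_iff, Nat.lt_succ_iff_lt_or_eq]
    constructor
    · rintro ⟨h1, h2 | h2⟩
      · exact Or.inr ⟨h1, h2⟩
      · exact Or.inl h2
    · rintro (h1 | ⟨h1, h2⟩)
      · exact ⟨(Fin.ext h1 : v = ⟨i, hi⟩) ▸ h, Or.inr h1⟩
      · exact ⟨h1, Or.inl h2⟩
  · rw [rankIn, rankIn, add_zero]
    congr 1
    ext v
    simp only [Finset.mem_filter]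
    refine and_congr_right fun hv => ?_
    have : (v : ℕ) ≠ i := fun h' => h ((Fin.ext h' : v = ⟨i, hi⟩) ▸ hv)
    omega

theorem rankIn_le {K : Finset (Fin n)} {i : ℕ} : rankIn K i ≤ K.card := Finset.card_filter_le _ _

theorem wp_rankVertices {K : Finset (Fin n)} (hW : 10 * (n + l.length + 1) ≤ W)
    (hB : Base l c k t σ) (hK : ∀ v : Fin n, σ.arr 3 v = 1 ↔ v ∈ K)
    (hQ : ∀ s' τ, s' ≤ s + 10 * n + 10 → Base l c k t τ → (∀ v : Fin n, τ.arr 3 v = 1 ↔ v ∈ K) →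
      τ.reg 13 = K.card → (∀ v ∈ K, τ.arr 7 (v : ℕ) = rankIn K v) → Q s' τ) :
    wp W Kernel.rankVertices Q s σ := by
  simp only [Kernel.rankVertices, wp_seq, wp_const]
  refine ⟨by omega, by omega, ?_⟩
  refine wp_loop_count (N := n) (fun i s' τ => s' ≤ s + 10 * i + 5 ∧ Base l c k t τ ∧
    τ.reg 6 = i ∧ i ≤ n ∧ (∀ v : Fin n, τ.arr 3 v = 1 ↔ v ∈ K) ∧ τ.reg 13 = rankIn K i ∧
    ∀ v ∈ K, (v : ℕ) < i → τ.arr 7 (v : ℕ) = rankIn K v) ?_ ?_ ?_ ?_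
  · rintro i s' τ ⟨-, hB, h6, hi, -⟩
    exact ⟨h6, hB.n, hi⟩
  · rintro i s' τ hi ⟨hs, hB, h6, -, hK, h13, h7⟩
    have hKi : τ.arr 3 i = 1 ↔ (⟨i, hi⟩ : Fin n) ∈ K := hK ⟨i, hi⟩
    have hle : rankIn K i ≤ n := rankIn_le.trans (by simpa using Finset.card_le_univ K)
    have o1 : rankIn K i + 1 ≤ W := by omega
    have o2 : i + 1 ≤ W := by omega
    have o3 : 0 ≤ W := by omega
    have hsucc := rankIn_succ (K := K) hi
    by_cases h : (⟨i, hi⟩ : Fin n) ∈ K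
    · rw [if_pos h] at hsucc
      simp [Kernel.skip, wp_seq, wp_const, wp_load, wp_store, wp_arith, wp_cond, RegTest.Holds,
        ArithOp.eval, h6, hB.one, hKi, h, h13, o1, o2, base_setReg, base_setArr, hB, hsucc, hK]
      refine ⟨by omega, by omega, fun v hv hvi => ?_⟩
      by_cases hvi' : (v : ℕ) = i
      · simp [hvi']
      · simp [hvi', h7 v hv (by omega)]
    · rw [if_neg h] at hsucc
      simp [Kernel.skip, wp_seq, wp_const, wp_load, wp_store, wp_arith, wp_cond, RegTest.Holds,
        ArithOp.eval, h6, hB.one, hKi, h, h13, o2, base_setReg, hB, hsucc, hK]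
      refine ⟨by omega, by omega, fun v hv hvi => h7 v hv ?_⟩
      have : (v : ℕ) ≠ i := fun h' => h ((Fin.ext h' : v = ⟨i, hi⟩) ▸ hv)
      omega
  · rintro s' τ ⟨hs, hB, h6, -, hK, h13, h7⟩
    refine hQ _ _ (by omega) hB hK ?_ fun v hv => h7 v hv v.isLt
    rw [h13, rankIn, Finset.filter_true_of_mem fun (v : Fin n) _ => v.isLt]
  · simp [base_setReg, hB, hK, rankIn]

/-- The edges with both endpoints in `K`. -/
def keptList (K : Finset (Fin n)) (l : List (Fin n × Fin n)) : List (Fin n × Fin n) :=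
  l.filter fun e => decide (e.1 ∈ K ∧ e.2 ∈ K)

/-- The edges with both endpoints in `K`, with their endpoints renamed. -/
def outList (K : Finset (Fin n)) (l : List (Fin n × Fin n)) : List (ℕ × ℕ) :=
  (keptList K l).map fun e => (rankIn K e.1, rankIn K e.2)

theorem outList_take_succ {K : Finset (Fin n)} {i : ℕ} (hi : i < l.length) :
    outList K (l.take (i + 1)) = if l[i].1 ∈ K ∧ l[i].2 ∈ K then
      outList K (l.take i) ++ [(rankIn K l[i].1, rankIn K l[i].2)] else outList K (l.take i) := by
  rw [List.take_succ_eq_append_getElem hi, outList, keptList, List.filter_append, List.map_append]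
  split_ifs with h
  · simp [h, outList, keptList]
  · simp [h, outList, keptList]

theorem length_outList_le {K : Finset (Fin n)} : (outList K l).length ≤ l.length := by
  rw [outList, List.length_map]
  exact List.length_filter_le _ _

/-- The memory when the edges in `out` have been written and the first `i` edges have been read. -/
structure WriteState (l : List (Fin n × Fin n)) (c k : ℕ) (K : Finset (Fin n)) (i : ℕ)
    (out : List (ℕ × ℕ)) (σ : Memory) : Prop where
  reg_zero : σ.reg 0 = n
  m : σ.reg 1 = l.length
  colors : σ.reg 2 = c
  budget : σ.reg 3 = k
  one : σ.reg 5 = 1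
  zero : σ.reg 12 = 0
  card : σ.reg 13 = K.card
  idx : σ.reg 6 = i
  length : σ.reg 14 = out.length
  mem : ∀ v : Fin n, σ.arr 3 v = 1 ↔ v ∈ K
  rank : ∀ v ∈ K, σ.arr 7 (v : ℕ) = rankIn K v
  written : ∀ j p, out[j]? = some p → σ.arr 0 j = p.1 ∧ σ.arr 1 j = p.2
  rest : ∀ j (hj : j < l.length), i ≤ j → σ.arr 0 j = l[j].1 ∧ σ.arr 1 j = l[j].2

theorem wp_writeEdges {K : Finset (Fin n)} (hW : 10 * (n + l.length + 1) ≤ W)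
    (hB : Base l c k t σ) (hK : ∀ v : Fin n, σ.arr 3 v = 1 ↔ v ∈ K) (h13 : σ.reg 13 = K.card)
    (h7 : ∀ v ∈ K, σ.arr 7 (v : ℕ) = rankIn K v)
    (hQ : ∀ s' τ, s' ≤ s + 20 * l.length + 10 → WriteState l c k K l.length (outList K l) τ →
      Q s' τ) :
    wp W Kernel.writeEdges Q s σ := by
  simp only [Kernel.writeEdges, wp_seq, wp_const]
  refine ⟨by omega, by omega, ?_⟩
  refine wp_loop_count (N := l.length) (fun i s' τ => s' ≤ s + 20 * i + 5 ∧ i ≤ l.length ∧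
    WriteState l c k K i (outList K (l.take i)) τ) ?_ ?_ ?_ ?_
  · rintro i s' τ ⟨-, hi, hS⟩
    exact ⟨hS.idx, hS.m, hi⟩
  · rintro i s' τ hi ⟨hs, -, hS⟩
    have hout := outList_take_succ (K := K) hi
    have hlen : (outList K (l.take i)).length ≤ i := by
      refine length_outList_le.trans ?_
      simp
    obtain ⟨hfst, hsnd⟩ := hS.rest i hi le_rfl
    generalize l[i].1 = a at *
    generalize l[i].2 = b at *
    have o1 : i + 1 ≤ W := by omega
    have o2 : (outList K (l.take i)).length + 1 ≤ W := by omega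
    have o3 : 0 ≤ W := by omega
    by_cases hab : a ∈ K ∧ b ∈ K
    · rw [if_pos hab] at hout
      simp [Kernel.skip, Kernel.loadEdge, wp_seq, wp_const, wp_load, wp_store, wp_arith, wp_cond,
        RegTest.Holds, ArithOp.eval, hS.idx, hS.one, hfst, hsnd, hS.mem, hab, hS.length,
        hS.rank a hab.1, hS.rank b hab.2, o1, o2]
      refine ⟨by omega, by omega, ?_⟩
      rw [hout]
      refine ⟨by simp [hS.reg_zero], by simp [hS.m], by simp [hS.colors], by simp [hS.budget], by simp [hS.one],
        by simp [hS.zero], by simp [hS.card], by simp, by simp, by simp [hS.mem],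
        fun v hv => by simp [hS.rank v hv], fun j p hj => ?_, fun j hj hij => ?_⟩
      · by_cases hjl : j = (outList K (l.take i)).length
        · subst hjl
          rw [List.getElem?_append_right le_rfl] at hj
          simp at hj
          simp [← hj]
        · by_cases hjl' : j < (outList K (l.take i)).length
          · rw [List.getElem?_append_left hjl'] at hj
            simp [hjl, hS.written j p hj]
          · rw [List.getElem?_eq_none (by simp; omega)] at hj
            cases hj
      -- The cell just written has an index at most `i`, so the edges that are still unread are
      -- intact.
      · have hne : j ≠ (outList K (l.take i)).length := by omega
        simp [hne, hS.rest j hj (by omega)]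
    · rw [if_neg hab] at hout
      have hfin : ∀ ρ : Memory, ρ.arr = τ.arr →
          (∀ x, x < 6 ∨ 12 ≤ x → ρ.reg x = τ.reg x) → ρ.reg 6 = i + 1 →
          WriteState l c k K (i + 1) (outList K (l.take (i + 1))) ρ := by
        intro ρ harr hreg h6
        rw [hout]
        refine ⟨?_, ?_, ?_, ?_, ?_, ?_, ?_, h6, ?_, ?_, ?_, ?_, ?_⟩
        · rw [hreg _ (by omega), hS.reg_zero]
        · rw [hreg _ (by omega), hS.m]
        · rw [hreg _ (by omega), hS.colors]
        · rw [hreg _ (by omega), hS.budget]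
        · rw [hreg _ (by omega), hS.one]
        · rw [hreg _ (by omega), hS.zero]
        · rw [hreg _ (by omega), hS.card]
        · rw [hreg _ (by omega), hS.length]
        · rw [harr]; exact hS.mem
        · rw [harr]; exact hS.rank
        · rw [harr]; exact hS.written
        · rw [harr]; exact fun j hj hij => hS.rest j hj (by omega)
      have hreg : ∀ (ρ : Memory) x v, 6 ≤ x → x < 12 → (∀ y, y < 6 ∨ 12 ≤ y → ρ.reg y = τ.reg y) →
          ∀ y, y < 6 ∨ 12 ≤ y → (ρ.setReg x v).reg y = τ.reg y := by
        intro ρ x v h1 h2 h y hy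
        rw [reg_setReg, if_neg (by omega), h y hy]
      by_cases ha : a ∈ K
      · have hb : b ∉ K := fun h => hab ⟨ha, h⟩
        simp only [Kernel.skip, Kernel.loadEdge, wp_seq, wp_const, wp_load, wp_store, wp_arith,
          wp_cond, RegTest.Holds, ArithOp.eval]
        simp [hS.idx, hS.one, hfst, hsnd, hS.mem, ha, hb, o1]
        refine ⟨by omega, by omega, hfin _ (by simp) ?_ (by simp)⟩
        iterate 6 refine hreg _ _ _ (by omega) (by omega) ?_
        exact fun _ _ => rfl
      · simp only [Kernel.skip, Kernel.loadEdge, wp_seq, wp_const, wp_load, wp_store, wp_arith,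
          wp_cond, RegTest.Holds, ArithOp.eval]
        simp [hS.idx, hS.one, hfst, hsnd, hS.mem, ha, o1]
        refine ⟨by omega, by omega, hfin _ (by simp) ?_ (by simp)⟩
        iterate 6 refine hreg _ _ _ (by omega) (by omega) ?_
        exact fun _ _ => rfl
  · rintro s' τ ⟨hs, -, hS⟩
    rw [List.take_length] at hS
    exact hQ _ _ (by omega) hS
  · refine ⟨by omega, by omega, ?_⟩
    exact ⟨by simp [hB.n], by simp [hB.m], by simp [hB.c], by simp [hB.k], by simp [hB.one],
      by simp [hB.zero], by simp [h13], by simp, by simp [outList, keptList], by simp [hK],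
      fun v hv => by simp [h7 v hv], fun j p hj => by simp [outList, keptList] at hj,
      fun j hj _ => by simp [hB.fst j hj, hB.snd j hj]⟩

theorem wp_writeHeader {K : Finset (Fin n)} {out : List (ℕ × ℕ)}
    (hW : n + out.length ≤ W) (hS : WriteState l c k K l.length out σ)
    (hQ : ∀ s' τ, s' ≤ s + 10 → τ.reg 0 = K.card → τ.reg 1 = out.length → τ.reg 2 = c →
      τ.reg 3 = min k out.length →
      (∀ j p, out[j]? = some p → τ.arr 0 j = p.1 ∧ τ.arr 1 j = p.2) → Q s' τ) :
    wp W Kernel.writeHeader Q s σ := by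
  have hcard : K.card ≤ n := by simpa using Finset.card_le_univ K
  have o1 : K.card ≤ W := by omega
  have o2 : out.length ≤ W := by omega
  simp only [Kernel.writeHeader, Kernel.skip, wp_seq, wp_arith, wp_cond, RegTest.Holds, ArithOp.eval,
    wp_const]
  simp [hS.card, hS.zero, hS.length, hS.budget, o1, o2]
  refine ⟨fun h => hQ _ _ (by omega) (by simp) (by simp) (by simp [hS.colors]) (by simp; omega) hS.written,
    fun h => hQ _ _ (by omega) (by simp) (by simp) (by simp [hS.colors])
      (by simp [hS.budget]; omega) hS.written⟩

/-- The specification of the main part of the program. -/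
theorem wp_main (hl : IsEdgeList G l) (hW : 10 * (n + l.length + c + t + 1) ≤ W)
    (hB : Base l c k t σ) (h0 : ∀ a i, 2 ≤ a → σ.arr a i = 0)
    (hQ : ∀ s' τ D K, s' ≤ s + 150 * n + 100 * l.length + 200 →
      IsPeeled (lowGraph G t) {v | (nbhd G v).card = t} D →
      (2 * t = c + 2 → ∀ v, IsStuck G t D v) → (2 * t ≠ c + 2 → D = ∅) →
      (∀ v, v ∈ K ↔ v ∈ D ∨ ∃ w, G.Adj v w ∧ (t < (nbhd G v).card ∨ t < (nbhd G w).card)) →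
      τ.reg 0 = K.card → τ.reg 1 = (outList K l).length → τ.reg 2 = c →
      τ.reg 3 = min k (outList K l).length →
      (∀ j p, (outList K l)[j]? = some p → τ.arr 0 j = p.1 ∧ τ.arr 1 j = p.2) → Q s' τ) :
    wp W Kernel.main Q s σ := by
  classical
  rw [Kernel.main, wp_seq]
  refine wp_countDegrees (W := W) hl (by omega) hB h0 fun s₁ σ₁ hs₁ hB₁ hdeg h0₁ => ?_
  rw [wp_seq]
  refine wp_classifyEdges (W := W) hl (by omega) hB₁ hdeg h0₁ fun s₂ σ₂ hs₂ hB₂ hC => ?_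
  rw [wp_seq]
  refine wp_peelIfEven hl hW hB₂ hC fun s₃ σ₃ D hs₃ hB₃ hD => ?_
  set K : Finset (Fin n) := Finset.univ.filter fun v => σ₃.arr 3 v = 1 with hK
  have hmem : ∀ v : Fin n, σ₃.arr 3 v = 1 ↔ v ∈ K := fun v => by simp [hK]
  rw [wp_seq]
  refine wp_rankVertices (W := W) (by omega) hB₃ hmem fun s₄ σ₄ hs₄ hB₄ hK₄ h13 h7 => ?_
  rw [wp_seq]
  refine wp_writeEdges (W := W) (by omega) hB₄ hK₄ h13 h7 fun s₅ σ₅ hs₅ hS => ?_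
  have hlen := length_outList_le (K := K) (l := l)
  refine wp_writeHeader (W := W) (by omega) hS fun s₆ τ hs₆ r0 r1 r2 r3 harr => ?_
  refine hQ s₆ τ D K (by omega) hD.peeled hD.stuck hD.empty (fun v => ?_) r0 r1 r2 r3 harr
  rw [← hmem, hD.keep, hl.isNearHigh_iff]

end Phases

/-! ### The output as an induced subgraph, and correctness of the kernelization -/

section Output

variable {n : ℕ} {G : SimpleGraph (Fin n)} {l : List (Fin n × Fin n)}

/-- The element with index `x` in the increasing enumeration of `K` has `x` predecessors in `K`. So
the new names invert the embedding of the kernel into `G`. -/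
theorem rankIn_orderEmbOfFin (K : Finset (Fin n)) (x : Fin K.card) :
    rankIn K (K.orderEmbOfFin rfl x) = x := by
  have : (K.filter fun v : Fin n => (v : ℕ) < K.orderEmbOfFin rfl x) =
      (Finset.Iio x).map (K.orderEmbOfFin rfl).toEmbedding := by
    ext v
    simp only [Finset.mem_filter, Finset.mem_map, Finset.mem_Iio, RelEmbedding.coe_toEmbedding]
    constructor
    · rintro ⟨hv, hlt⟩
      obtain ⟨y, rfl⟩ : v ∈ Set.range (K.orderEmbOfFin rfl) := by simpa using hv
      exact ⟨y, (K.orderEmbOfFin rfl).lt_iff_lt.1 hlt, rfl⟩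
    · rintro ⟨y, hy, rfl⟩
      exact ⟨Finset.orderEmbOfFin_mem _ _ _, (K.orderEmbOfFin rfl).lt_iff_lt.2 hy⟩
  rw [rankIn, this, Finset.card_map, Fin.card_Iio]

/-- The written edges are the edges of the subgraph that is induced by `K`. -/
theorem IsEdgeList.exists_outList (hl : IsEdgeList G l) (K : Finset (Fin n)) :
    ∃ l' : List (Fin K.card × Fin K.card),
      IsEdgeList (G.comap (K.orderEmbOfFin rfl)) l' ∧
      outList K l = l'.map fun e => ((e.1 : ℕ), (e.2 : ℕ)) := by
  set φ := K.orderEmbOfFin rfl with hφ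
  have hrange : ∀ v, v ∈ K ↔ ∃ x, φ x = v := fun v => by
    rw [← Set.mem_range, hφ, Finset.range_orderEmbOfFin, Finset.mem_coe]
  obtain ⟨l', hl'⟩ : keptList K l ∈ Set.range (List.map (Prod.map φ φ)) := by
    rw [Set.range_list_map]
    rintro ⟨a, b⟩ he
    obtain ⟨ha, hb⟩ : a ∈ K ∧ b ∈ K := by simpa using (List.mem_filter.1 he).2
    obtain ⟨x, rfl⟩ := (hrange a).1 ha
    obtain ⟨y, rfl⟩ := (hrange b).1 hb
    exact ⟨(x, y), rfl⟩
  have hmap : (l'.map fun e => s(e.1, e.2)).map (Sym2.map φ) =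
      (keptList K l).map fun e => s(e.1, e.2) := by
    rw [← hl', List.map_map, List.map_map]
    rfl
  have hinj : Function.Injective (Sym2.map φ) := Sym2.map.injective φ.injective
  refine ⟨l', ⟨?_, fun e => ?_⟩, ?_⟩
  · refine List.Nodup.of_map (Sym2.map φ) ?_
    rw [hmap]
    exact hl.1.sublist (List.filter_sublist.map _)
  · rw [← List.mem_map_of_injective hinj, hmap]
    induction e with
    | _ x y =>
      have hadj : s(x, y) ∈ (G.comap φ).edgeSet ↔ s(φ x, φ y) ∈ G.edgeSet := Iff.rfl
      rw [hadj, ← hl.2]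
      constructor
      · intro h
        obtain ⟨e, he, h⟩ := List.mem_map.1 h
        exact List.mem_map.2 ⟨e, (List.mem_filter.1 he).1, h⟩
      · intro h
        obtain ⟨⟨a, b⟩, he, h⟩ := List.mem_map.1 h
        refine List.mem_map.2 ⟨(a, b), List.mem_filter.2 ⟨he, ?_⟩, h⟩
        have hx := (hrange _).2 ⟨x, rfl⟩
        have hy := (hrange _).2 ⟨y, rfl⟩
        rcases Sym2.eq_iff.1 h with ⟨rfl, rfl⟩ | ⟨rfl, rfl⟩
        · simp [hx, hy]
        · simp [hx, hy]
  · rw [outList, ← hl', List.map_map]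
    refine List.map_congr_left fun e _ => ?_
    simp [hφ, rankIn_orderEmbOfFin]

/-- The handshake lemma in the induced subgraph, where degrees can only be smaller. The factor 2
turns the constant 8 of `card_kernel_le` into 4. -/
theorem two_mul_ncard_edgeSet_comap_le (K : Finset (Fin n)) :
    2 * (G.comap (K.orderEmbOfFin rfl)).edgeSet.ncard ≤ ∑ v ∈ K, (nbhd G v).card := by
  classical
  set φ := K.orderEmbOfFin rfl with hφ
  have h1 := (G.comap φ).sum_degrees_eq_twice_card_edges
  rw [Set.ncard_eq_toFinset_card', Set.toFinset_card, ← SimpleGraph.edgeFinset_card, ← h1]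
  calc ∑ x, (G.comap φ).degree x ≤ ∑ x, (nbhd G (φ x)).card := by
        refine Finset.sum_le_sum fun x _ => ?_
        refine Finset.card_le_card_of_injOn φ (fun y hy => ?_) φ.injective.injOn
        simpa using hy
    _ = ∑ v ∈ K, (nbhd G v).card := by
        refine (Finset.sum_map Finset.univ φ.toEmbedding fun v => (nbhd G v).card).symm.trans ?_
        congr 1
        ext v
        simp only [Finset.mem_map, Finset.mem_univ, true_and, RelEmbedding.coe_toEmbedding]
        rw [← Set.mem_range, hφ, Finset.range_orderEmbOfFin, Finset.mem_coe]

theorem exists_labeling_min_iff {V : Type*} [Finite V] (G : SimpleGraph V) (c k : ℕ) :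
    (∃ L : Sym2 V → Option (Fin c), IsSTCLabeling G L ∧
      (weakEdges G L).ncard ≤ min k G.edgeSet.ncard) ↔
    ∃ L : Sym2 V → Option (Fin c), IsSTCLabeling G L ∧ (weakEdges G L).ncard ≤ k := by
  refine exists_congr fun L => and_congr_right fun _ => ?_
  rw [le_min_iff, and_iff_left]
  exact Set.ncard_le_ncard (fun e he => he.1) (Set.toFinite _)

/-- The program with a preamble that computes the degree bound `t c` yields a kernelization. -/
theorem admitsLinearTimeKernel_of_preamble {C : Set ℕ} {f g : STCInstance → ℕ} {t : ℕ → ℕ}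
    {pre : Program} (htc : ∀ c, t c ≤ c + 1)
    (ht : ∀ c ∈ C, 2 * (t c - 1) < c ∨ (2 * (t c - 1) = c ∧ 3 ≤ t c))
    (hf : ∀ I : STCInstance, I.c ∈ C → 6 * xi I.graph (t I.c) * (t I.c + 1) ≤ 1000 * f I)
    (hg : ∀ I : STCInstance, I.c ∈ C → 4 * xi I.graph (t I.c) * (t I.c + 1) ^ 2 ≤ 1000 * g I)
    (hpre : ∀ W σ Q, 2 ≤ W → σ.reg 2 + 1 ≤ W →
      (∀ τ : Memory, τ.arr = σ.arr → (∀ x, x ≠ 4 → x ≠ 5 → x ≠ 9 → τ.reg x = σ.reg x) →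
        τ.reg 4 = t (σ.reg 2) → τ.reg 5 = 1 → ∀ s ≤ 10, Q s τ) → wp W pre Q 0 σ) :
    AdmitsLinearTimeKernel C f g := by
  -- A generous constant: it covers the running time, at most `150 * n + 100 * m + 210`, the word
  -- size, where `t ≤ c + 1`, and the constants of the kernel size.
  refine ⟨pre ;; Kernel.main, 1000, fun I hI l σ hσ => ?_⟩
  obtain ⟨⟨hl, r0, r1, r2, r3, hedges⟩, hreg, harr⟩ := hσ
  have hm : l.length = I.m := hl.length_eq
  have htI := htc I.c
  have key : wp (1000 * (I.n + I.m + I.c + I.k + 1)) (pre ;; Kernel.main) (fun s τ =>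
      ∃ (I' : STCInstance) (l' : List (Fin I'.n × Fin I'.n)), s ≤ 1000 * (I.n + I.m + 1) ∧
        Stores τ I' l' ∧ (I'.IsYes ↔ I.IsYes) ∧ I'.c = I.c ∧ I'.k ≤ I.k ∧ I'.k ≤ I'.m ∧
        I'.n ≤ 1000 * f I ∧ I'.m ≤ 1000 * g I) 0 σ := by
    rw [wp_seq]
    refine hpre _ _ _ (by omega) (by rw [r2]; omega) fun σ₁ harr₁ hreg₁ h4 h5 s₁ hs₁ => ?_
    have hB : Base l I.c I.k (t I.c) σ₁ := by
      refine ⟨?_, ?_, ?_, ?_, ?_, h5, ?_, fun i hi => ?_, fun i hi => ?_⟩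
      · rw [hreg₁ _ (by omega) (by omega) (by omega), r0]
      · rw [hreg₁ _ (by omega) (by omega) (by omega), r1]
      · rw [hreg₁ _ (by omega) (by omega) (by omega), r2]
      · rw [hreg₁ _ (by omega) (by omega) (by omega), r3]
      · rw [h4, r2]
      · rw [hreg₁ _ (by omega) (by omega) (by omega), hreg _ (by omega)]
      · rw [harr₁, (hedges i hi).1]
      · rw [harr₁, (hedges i hi).2]
    refine wp_main (W := 1000 * (I.n + I.m + I.c + I.k + 1)) hl (by omega) hB
      (fun a i ha => by rw [harr₁, harr a i (Or.inl ha)])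
      fun s' τ D K hs' hpeel hstuck hempty hK q0 q1 q2 q3 hout => ?_
    obtain ⟨l', hl', hl'out⟩ := hl.exists_outList K
    have hlen : (outList K l).length = l'.length := by rw [hl'out, List.length_map]
    have hDt : D = ∅ ∨ 3 ≤ t I.c := by
      by_cases h : 2 * t I.c = I.c + 2
      · right
        rcases ht I.c hI with h' | h' <;> omega
      · exact Or.inl (hempty h)
    obtain ⟨hn', hm'⟩ := card_kernel_le hpeel hDt (fun v hv => (hK v).1 hv)
    have hedge := two_mul_ncard_edgeSet_comap_le (G := I.graph) K
    have hfI := hf I hI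
    have hgI := hg I hI
    have hred : IsReduced I.graph I.c (t I.c) (D : Set (Fin I.n)) := by
      rcases ht I.c hI with h | ⟨h1, h2⟩
      · exact Or.inl h
      · refine Or.inr ⟨h1, h2, fun u hu hut => ?_⟩
        obtain ⟨v, hv, w, hw, hvw⟩ := Finset.one_lt_card.1
          (hstuck (by omega) u (by simpa using hu) hut)
        simp only [Finset.mem_sdiff, mem_nbhd] at hv hw
        exact ⟨v, w, hvw, hv.1, hw.1, by simpa using hv.2, by simpa using hw.2⟩
    have hrange : Set.range (K.orderEmbOfFin rfl).toEmbedding = (K : Set (Fin I.n)) :=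
      Finset.range_orderEmbOfFin K rfl
    have hiff := exists_labeling_iff (k := I.k) (K.orderEmbOfFin rfl).toEmbedding hred
      (by rw [hrange]; exact fun v hv => (hK v).2 (Or.inl hv))
      (by
        rw [hrange]
        exact fun u v huv hu => ⟨(hK u).2 (Or.inr ⟨v, huv, Or.inl hu⟩),
          (hK v).2 (Or.inr ⟨u, huv.symm, Or.inr hu⟩)⟩)
    refine ⟨⟨K.card, I.graph.comap (K.orderEmbOfFin rfl), I.c, min I.k l'.length⟩, l', by omega,
      ⟨hl', q0, by rw [q1, hlen], q2, by rw [q3, hlen], fun i hi => ?_⟩, ?_, rfl,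
      min_le_left _ _, ?_, hn'.trans hfI, ?_⟩
    · refine hout i ((l'[i].1 : ℕ), (l'[i].2 : ℕ)) ?_
      rw [hl'out, List.getElem?_map, List.getElem?_eq_getElem hi]
      rfl
    · rw [hl'.length_eq]
      exact (exists_labeling_min_iff _ _ _).trans hiff
    · rw [hl'.length_eq]
      exact min_le_right _ _
    · change (I.graph.comap (K.orderEmbOfFin rfl)).edgeSet.ncard ≤ _
      nlinarith
  obtain ⟨s, τ, hexec, I', l', h1, h2⟩ := key
  exact ⟨s, τ, I', l', hexec, by omega, h2⟩

end Output

end MultiSTC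

/-! ### The two choices of the degree bound -/

theorem theorem3 :
    MultiSTC.AdmitsLinearTimeKernel {c : ℕ | 3 ≤ c}
      (fun I => MultiSTC.xi I.graph (I.c / 2 + 1) * I.c)
      (fun I => MultiSTC.xi I.graph (I.c / 2 + 1) * I.c ^ 2) ∧
    MultiSTC.AdmitsLinearTimeKernel {c : ℕ | 1 ≤ c ∧ c ≤ 4}
      (fun I => MultiSTC.xi I.graph (I.c - 1))
      (fun I => MultiSTC.xi I.graph (I.c - 1)) := by
  open MultiSTC in
  constructor
  -- Here `2 * (t - 1)` is `c - 1` for odd `c` and `c` for even `c`. In the even case `c ≥ 4`, so `t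
  -- ≥ 3`.
  · refine admitsLinearTimeKernel_of_preamble (t := fun c => c / 2 + 1)
      (pre := .const 5 1 ;; .const 9 2 ;; .arith .div 4 2 9 ;; .arith .add 4 4 5)
      (fun c => by omega) (fun c hc => ?_) (fun I hI => ?_) (fun I hI => ?_) ?_
    · change 3 ≤ c at hc
      omega
    · change 3 ≤ I.c at hI
      have h : I.c / 2 + 1 + 1 ≤ 2 * I.c := by omega
      have := Nat.mul_le_mul_left (6 * xi I.graph (I.c / 2 + 1)) h
      nlinarith
    · change 3 ≤ I.c at hI
      have h : I.c / 2 + 1 + 1 ≤ 2 * I.c := by omega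
      have := Nat.mul_le_mul_left (4 * xi I.graph (I.c / 2 + 1)) (Nat.pow_le_pow_left h 2)
      nlinarith
    · intro W σ Q hW hW' hQ
      have o1 : 1 ≤ W := by omega
      have o2 : σ.reg 2 / 2 ≤ W := by omega
      have o3 : σ.reg 2 / 2 + 1 ≤ W := by omega
      simp [wp_seq, wp_const, wp_arith, ArithOp.eval, hW, o1, o2, o3]
      refine hQ _ (by simp) (fun x h1 h2 h3 => by simp [h1, h2, h3]) (by simp) (by simp) _ (by omega)
  -- For `c ≤ 3` there is a color to spare (for `c = 1` with `t = 0` and truncated subtraction), and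
  -- `c = 4` with `t = 3` is the sharp case. As `t + 1 ≤ 4`, the factors in `t` are absorbed by the
  -- constant.
  · refine admitsLinearTimeKernel_of_preamble (t := fun c => c - 1)
      (pre := .const 5 1 ;; .arith .sub 4 2 5)
      (fun c => by omega) (fun c hc => ?_) (fun I hI => ?_) (fun I hI => ?_) ?_
    · change 1 ≤ c ∧ c ≤ 4 at hc
      omega
    · change 1 ≤ I.c ∧ I.c ≤ 4 at hI
      have h : I.c - 1 + 1 ≤ 4 := by omega
      have := Nat.mul_le_mul_left (6 * xi I.graph (I.c - 1)) h
      omega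
    · change 1 ≤ I.c ∧ I.c ≤ 4 at hI
      have h : I.c - 1 + 1 ≤ 4 := by omega
      have := Nat.mul_le_mul_left (4 * xi I.graph (I.c - 1)) (Nat.pow_le_pow_left h 2)
      omega
    · intro W σ Q hW hW' hQ
      have o1 : 1 ≤ W := by omega
      have o2 : σ.reg 2 ≤ W + 1 := by omega
      simp [wp_seq, wp_const, wp_arith, ArithOp.eval, o1, o2]
      refine hQ _ (by simp) (fun x h1 h2 h3 => by simp [h1, h2]) (by simp) (by simp) _ (by omega)
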